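/- Let $k$ be an algebraically closed field and let $\mathcal C$ be a $k$-linear, Hom-finite, Krull-Remak-Schmidt triangulated category with shift $[1]$. A *subcategory* is a full subcategory closed under isomorphisms, finite direct sums and direct summands; equality of subcategories means equality of their classes of objects. For subcategories $\mathcal D,\mathcal X,\mathcal Y$ of $\mathcal C$, $[\mathcal D](X,Y)$ denotes the set of morphisms $X\to Y$ that factor through an object of $\mathcal D$, and $\mathcal X\ast\mathcal Y$ is the class of objects $M$ in a triangle $X\to M\to Y\to X[1]$ with $X\in\mathcal X$, $Y\in\mathcal Y$. A subcategory $\mathcal T$ is *cluster tilting* if it is functorially finite and $\mathcal T=\{M:\operatorname{Hom}(\mathcal T,M[1])=0\}=\{M:\operatorname{Hom}(M,\mathcal T[1])=0\}$. Fix a cluster tilting subcategory $\mathcal T$ of $\mathcal C$. A subcategory $\mathcal X$ of $\mathcal C$ is *weak $\mathcal T[1]$-cluster tilting* if $\mathcal T\subseteq\mathcal X[-1]\ast\mathcal X$ and $$\mathcal X=\{M\in\mathcal C : [\mathcal T[1]](M,\mathcal X[1])=0 \text{ and } [\mathcal T[1]](\mathcal X,M[1])=0\};\qquad(\ast)$$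 it is *$\mathcal T[1]$-cluster tilting* if it is contravariantly finite in $\mathcal C$ and satisfies $(\ast)$. Its *factorization ideals vanish* if every morphism between objects of $\mathcal T[1]$ that factors through an object of $\mathcal X$ is zero. Let $\operatorname{mod}\mathcal T$ be the (abelian) category of finitely presented contravariant $k$-linear functors from $\mathcal T$ to $k$-vector spaces, and let $\mathbb H\colon\mathcal C\to\operatorname{mod}\mathcal T$, $M\mapsto\operatorname{Hom}_{\mathcal C}(-,M)|_{\mathcal T}$. A subcategory $\mathcal M$ of $\operatorname{mod}\mathcal T$ is *weak tilting* if (T1) $\operatorname{Ext}^1(\mathcal M,\mathcal M)=0$; (T2) $\operatorname{pd}M\le 1$ for all $M\in\mathcal M$; (T3) for every projective $P$ in $\operatorname{mod}\mathcal T$ there is a short exact sequence $0\to P\to M_0\to M_1\to0$ with $M_0,M_1\in\mathcal M$. It is *tilting* if moreover (T4) $\mathcal M$ is contravariantly finite in $\operatorname{mod}\mathcal T$. For a subcategory $\mathcal X$ of $\mathcal C$ let $\mathbb H(\mathcal X)$ be the class of modules isomorphic to $\mathbb H(X)$ for some $X\in\mathcal X$. For every weak tilting subcategory $\mathcal Y$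 of $\operatorname{mod}\mathcal T$ there is exactly one weak $\mathcal T[1]$-cluster tilting subcategory $\mathcal X$ of $\mathcal C$ with $\mathbb H(\mathcal X)=\mathcal Y$; it is denoted $\mathbb H^{-1}(\mathcal Y)$. The map $\Phi\colon\mathcal X\mapsto\mathbb H(\mathcal X)$ is a bijection from the first to the second of the following sets: (I) weak $\mathcal T[1]$-cluster tilting subcategories of $\mathcal C$ whose objects have no non-zero direct summands in $\mathcal T[1]$ and whose factorization ideals vanish; (II) weak tilting subcategories of $\operatorname{mod}\mathcal T$. It restricts to a bijection from the first to the second of the following sets: (I) $\mathcal T[1]$-cluster tilting subcategories of $\mathcal C$ whose objects have no non-zero direct summands in $\mathcal T[1]$ and whose factorization ideals vanish; (II) tilting subcategories $\mathcal Y$ of $\operatorname{mod}\mathcal T$ such that $\mathbb H^{-1}(\mathcal Y)$ is contravariantly finite in $\mathcal C$. Moreover, if $\mathcal C$ has a Serre functor $\mathbb S$ (an autoequivalence with $k$-linear isomorphisms $\operatorname{Hom}(A,B)\cong D\operatorname{Hom}(B,\mathbb SA)$ natural in $A$ and $B$, where $D$ is the $k$-dual), put $\tau=\mathbb S[-1]$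 and $F=\tau^{-1}\circ[1]$, and call a subcategory $\mathcal M$ *$F$-stable* if $F(\mathcal M)=\mathcal M$. Then $\Phi$ restricts to a bijection from the first to the second of the following sets: (I) cluster tilting subcategories of $\mathcal C$ whose objects have no non-zero direct summands in $\mathcal T[1]$ and whose factorization ideals vanish; (II) tilting subcategories $\mathcal Y$ of $\operatorname{mod}\mathcal T$ such that $\mathbb H^{-1}(\mathcal Y)$ is contravariantly finite in $\mathcal C$ and $F$-stable. -/

import Mathlib

open CategoryTheory CategoryTheory.Limits CategoryTheory.Pretriangulated

universe w v u

namespace GhostTilting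

/-! ### Subcategories and approximations

A full subcategory is given by the property of objects that cuts it out. -/

section General

variable {A : Type u} [Category.{v} A]

/-- The standing convention on subcategories: full, and closed under isomorphisms, finite direct
sums (the empty one included) and direct summands.  In the preadditive categories used here, finite
products are finite direct sums; in a triangulated or an abelian category direct summands are the
same as retracts (and closure under retracts contains closure under isomorphisms). -/
structure IsSubcat (P : ObjectProperty A) : Prop where
  finiteSums : P.IsClosedUnderFiniteProducts
  summands : P.IsStableUnderRetracts

/-- `f : D ⟶ X` is a right `P`-approximation of `X`. -/
def IsRightApprox (P : ObjectProperty A) {D X : A} (f : D ⟶ X) : Prop :=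
  P D ∧ ∀ (D' : A), P D' → ∀ g : D' ⟶ X, ∃ h : D' ⟶ D, h ≫ f = g

/-- `f : X ⟶ D` is a left `P`-approximation of `X`. -/
def IsLeftApprox (P : ObjectProperty A) {X D : A} (f : X ⟶ D) : Prop :=
  P D ∧ ∀ (D' : A), P D' → ∀ g : X ⟶ D', ∃ h : D ⟶ D', f ≫ h = g

def ContravariantlyFinite (P : ObjectProperty A) : Prop :=
  ∀ X : A, ∃ (D : A) (f : D ⟶ X), IsRightApprox P f

def CovariantlyFinite (P : ObjectProperty A) : Prop :=
  ∀ X : A, ∃ (D : A) (f : X ⟶ D), IsLeftApprox P f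

/-- `[P](X, Y) = 0`: every morphism `X ⟶ Y` that factors through an object of `P` is zero. -/
def IdealVanishes [HasZeroMorphisms A] (P : ObjectProperty A) (X Y : A) : Prop :=
  ∀ (Z : A), P Z → ∀ (f : X ⟶ Z) (g : Z ⟶ Y), f ≫ g = 0

end General

/-! ### Homological notions in an abelian category

They are phrased through short exact sequences, which only need zero morphisms to be stated. -/

section Abelian

variable {A : Type u} [Category.{v} A] [Preadditive A]

/-- `Ext¹(M, N) = 0`: every extension `0 ⟶ N ⟶ E ⟶ M ⟶ 0` splits. -/
def ExtOneVanishes (M N : A) : Prop :=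
  ∀ (E : A) (i : N ⟶ E) (p : E ⟶ M) (zero : i ≫ p = 0),
    (ShortComplex.mk i p zero).ShortExact → Nonempty (ShortComplex.mk i p zero).Splitting

/-- `pd M ≤ 1`: there is a projective resolution `0 ⟶ P₁ ⟶ P₀ ⟶ M ⟶ 0`. -/
def ProjDimLEOne (M : A) : Prop :=
  ∃ (P₁ P₀ : A) (i : P₁ ⟶ P₀) (p : P₀ ⟶ M) (zero : i ≫ p = 0),
    Projective P₁ ∧ Projective P₀ ∧ (ShortComplex.mk i p zero).ShortExact

/-- Weak tilting subcategories (of an abelian category). -/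
structure IsWeakTilting (M : ObjectProperty A) : Prop where
  isSubcat : IsSubcat M
  ext_vanishes : ∀ X Y : A, M X → M Y → ExtOneVanishes X Y
  projDim_le_one : ∀ X : A, M X → ProjDimLEOne X
  coresolution : ∀ P : A, Projective P →
    ∃ (M₀ M₁ : A) (i : P ⟶ M₀) (p : M₀ ⟶ M₁) (zero : i ≫ p = 0),
      M M₀ ∧ M M₁ ∧ (ShortComplex.mk i p zero).ShortExact

/-- Tilting subcategories (of an abelian category). -/
structure IsTilting (M : ObjectProperty A) : Prop extends IsWeakTilting M where
  contravariantlyFinite : ContravariantlyFinite M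

end Abelian

/-! ### Finitely presented modules over a linear category -/

section Modules

variable (k : Type w) [Field k] (A : Type u) [Category.{v} A] [Preadditive A] [Linear k A]

/-- A contravariant functor `F` from `A` to `k`-vector spaces is a finitely presented `A`-module:
it is `k`-linear and there is an exact sequence `A(-, A₁) ⟶ A(-, A₀) ⟶ F ⟶ 0` (exactness of
functors is exactness at every object). -/
structure IsFinPresModule (F : Aᵒᵖ ⥤ ModuleCat.{v} k) : Prop where
  additive : F.Additive
  linear : ∀ {X Y : A} (r : k) (f : X ⟶ Y), F.map (r • f).op = r • F.map f.op
  presentation : ∃ (A₁ A₀ : A) (f : (linearYoneda k A).obj A₁ ⟶ (linearYoneda k A).obj A₀)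
    (g : (linearYoneda k A).obj A₀ ⟶ F), ∀ X : Aᵒᵖ,
      Function.Exact (f.app X).hom (g.app X).hom ∧ Function.Surjective (g.app X).hom

/-- The category `mod A` of finitely presented `A`-modules. -/
abbrev FPMod : Type _ :=
  ObjectProperty.FullSubcategory (fun F : Aᵒᵖ ⥤ ModuleCat.{v} k => IsFinPresModule k A F)

end Modules

/-! ### Triangulated categories -/

section Triangulated

variable (C : Type u) [Category.{v} C] [Preadditive C] [HasZeroObject C] [HasShift C ℤ]
  [∀ n : ℤ, (shiftFunctor C n).Additive] [Pretriangulated C]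

/-- The Krull-Remak-Schmidt property: every object is a finite direct sum of objects with local
endomorphism rings. -/
def IsKrullSchmidt : Prop :=
  ∀ X : C, ∃ (n : ℕ) (Y : Fin n → C), (∀ i, IsLocalRing (End (Y i))) ∧ Nonempty (X ≅ ⨁ Y)

variable {C}

/-- The subcategory `P[n]`. -/
abbrev sh (P : ObjectProperty C) (n : ℤ) : ObjectProperty C := P.map (shiftFunctor C n)

/-- Cluster tilting subcategories; `Ext¹(X, Y)` is `Hom(X, Y[1])`. -/
structure IsClusterTilting (T : ObjectProperty C) : Prop where
  isSubcat : IsSubcat T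
  covariantlyFinite : CovariantlyFinite T
  contravariantlyFinite : ContravariantlyFinite T
  mem_iff_right : ∀ M : C, T M ↔ ∀ X : C, T X → ∀ f : X ⟶ M⟦(1 : ℤ)⟧, f = 0
  mem_iff_left : ∀ M : C, T M ↔ ∀ X : C, T X → ∀ f : M ⟶ X⟦(1 : ℤ)⟧, f = 0

/-- `X = {M | [T[1]](M, X[1]) = 0 and [T[1]](X, M[1]) = 0}`. -/
def IsGhostPerp (T X : ObjectProperty C) : Prop :=
  ∀ M : C, X M ↔
    (∀ Y : C, X Y → IdealVanishes (sh T 1) M (Y⟦(1 : ℤ)⟧)) ∧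
    (∀ Y : C, X Y → IdealVanishes (sh T 1) Y (M⟦(1 : ℤ)⟧))

/-- Weak `T[1]`-cluster tilting subcategories.  The second condition is `T ⊆ X[-1] ∗ X`. -/
structure IsWeakGhostClusterTilting (T X : ObjectProperty C) : Prop where
  isSubcat : IsSubcat X
  le_extension : T ≤ ObjectProperty.extensionProduct (sh X (-1)) X
  perp : IsGhostPerp T X

/-- `T[1]`-cluster tilting subcategories. -/
structure IsGhostClusterTilting (T X : ObjectProperty C) : Prop where
  isSubcat : IsSubcat X
  contravariantlyFinite : ContravariantlyFinite X
  perp : IsGhostPerp T X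

/-- The objects of `X` have no non-zero direct summands in `T[1]`. -/
def NoSummandsInShift (T X : ObjectProperty C) : Prop :=
  ∀ M N L : C, X M → Nonempty (M ≅ N ⊞ L) → sh T 1 N → IsZero N

/-- The factorization ideals of `X` vanish: for every `M` in `X`, each morphism between objects of
`T[1]` that factors through `M` is zero. -/
def FactorizationIdealVanishes (T X : ObjectProperty C) : Prop :=
  ∀ M : C, X M → ∀ (Z Z' : C), sh T 1 Z → sh T 1 Z' → ∀ (f : Z ⟶ M) (g : M ⟶ Z'), f ≫ g = 0

end Triangulated

/-! ### Serre functors -/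

section Serre

/-- A Serre functor: an autoequivalence `S` with isomorphisms `Hom(X, Y) ≃ D Hom(Y, S X)` of
`k`-vector spaces which are natural in `X` and in `Y`. -/
structure SerreFunctor (k : Type w) [Field k] (C : Type u) [Category.{v} C] [Preadditive C]
    [Linear k C] where
  S : C ≌ C
  duality (X Y : C) : (X ⟶ Y) ≃ₗ[k] Module.Dual k (Y ⟶ S.functor.obj X)
  natural_left : ∀ {X' X Y : C} (a : X' ⟶ X) (f : X ⟶ Y) (g : Y ⟶ S.functor.obj X'),
    duality X' Y (a ≫ f) g = duality X Y f (g ≫ S.functor.map a)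
  natural_right : ∀ {X Y Y' : C} (f : X ⟶ Y) (b : Y ⟶ Y') (g : Y' ⟶ S.functor.obj X),
    duality X Y' (f ≫ b) g = duality X Y f (b ≫ g)

variable {k : Type w} [Field k] {C : Type u} [Category.{v} C] [Preadditive C] [Linear k C]
  [HasShift C ℤ]

/-- The Auslander-Reiten translation `τ = S[-1]`. -/
noncomputable def SerreFunctor.tau (S : SerreFunctor k C) : C ≌ C :=
  S.S.trans (shiftEquiv C (1 : ℤ)).symm

/-- The functor `F = τ⁻¹ ∘ [1]`. -/
noncomputable def SerreFunctor.F (S : SerreFunctor k C) : C ⥤ C :=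
  shiftFunctor C (1 : ℤ) ⋙ S.tau.inverse

/-- `F(P) = P`, for a subcategory `P`. -/
def SerreFunctor.FStable (S : SerreFunctor k C) (P : ObjectProperty C) : Prop :=
  P.map S.F = P

end Serre

/-! ### The functor to modules -/

section H

variable (k : Type w) [Field k] {C : Type u} [Category.{v} C] [Preadditive C] [Linear k C]

/-- The restricted Yoneda functor `M ↦ Hom(-, M)|_T`. -/
def restrictedYoneda (T : ObjectProperty C) :
    C ⥤ (T.FullSubcategoryᵒᵖ ⥤ ModuleCat.{v} k) :=
  linearYoneda k C ⋙ (Functor.whiskeringLeft _ _ _).obj T.ι.op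

variable [HasZeroObject C] [HasShift C ℤ] [∀ n : ℤ, (shiftFunctor C n).Additive]
  [Pretriangulated C]

/-- The restricted Yoneda functor takes values in finitely presented modules. -/
theorem restrictedYoneda_finPres {T : ObjectProperty C} (hT : IsClusterTilting T) (M : C) :
    IsFinPresModule k T.FullSubcategory ((restrictedYoneda k T).obj M) := by
  obtain ⟨T₀, p, hT₀, hp⟩ := hT.contravariantlyFinite M
  obtain ⟨T₁, i, q, hD⟩ := distinguished_cocone_triangle₁ p
  have hT₁ : T T₁ := by
    rw [hT.mem_iff_right]
    intro X hX f
    have h1 : f ≫ i⟦(1 : ℤ)⟧' = 0 := (hT.mem_iff_right T₀).1 hT₀ X hX _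
    obtain ⟨g, hg⟩ := Triangle.coyoneda_exact₁ _ hD f h1
    obtain ⟨h, hh⟩ := hp X hX g
    have h2 : p ≫ q = 0 := comp_distTriang_mor_zero₂₃ _ hD
    change f = g ≫ q at hg
    have h3 : (h ≫ p) ≫ q = 0 := by rw [Category.assoc, h2, comp_zero]
    rw [hg, ← hh]
    exact h3
  refine ⟨⟨?_⟩, ?_, ⟨T₁, hT₁⟩, ⟨T₀, hT₀⟩,
    (linearYoneda k T.FullSubcategory).map (ObjectProperty.homMk i),
    { app := fun X => ModuleCat.ofHom
        { toFun := fun f => f.hom ≫ p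
          map_add' := fun f g => Preadditive.add_comp _ _ _ _ _ _
          map_smul' := fun r f => Linear.smul_comp _ _ _ _ _ _ }
      naturality := ?_ }, ?_⟩
  · intro X Y f g
    ext x
    exact Preadditive.add_comp _ _ _ _ _ _
  · intro X Y r f
    ext x
    exact Linear.smul_comp _ _ _ _ _ _
  · intro X Y f
    ext x
    exact Category.assoc _ _ _
  · intro X
    refine ⟨?_, ?_⟩
    · intro f
      constructor
      · intro hf
        obtain ⟨g, hg⟩ := Triangle.coyoneda_exact₂ _ hD f.hom hf
        exact ⟨ObjectProperty.homMk g, ObjectProperty.hom_ext _ hg.symm⟩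
      · rintro ⟨g, rfl⟩
        have h2 : i ≫ p = 0 := comp_distTriang_mor_zero₁₂ _ hD
        change (g.hom ≫ i) ≫ p = 0
        rw [Category.assoc, h2, comp_zero]
    · intro f
      obtain ⟨g, hg⟩ := hp X.unop.obj X.unop.property f
      exact ⟨ObjectProperty.homMk g, hg⟩

/-- The functor `ℍ : C ⥤ mod T`, `M ↦ Hom(-, M)|_T`. -/
def HFunctor {T : ObjectProperty C} (hT : IsClusterTilting T) :
    C ⥤ FPMod k T.FullSubcategory :=
  ObjectProperty.lift _ (restrictedYoneda k T) (restrictedYoneda_finPres k hT)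

/-- The subcategory `ℍ(X)` of `mod T`: the modules isomorphic to `ℍ(M)` for some `M` in `X`. -/
def HImage {T : ObjectProperty C} (hT : IsClusterTilting T) (X : ObjectProperty C) :
    ObjectProperty (FPMod k T.FullSubcategory) :=
  X.map (HFunctor k hT)

/-- `ℍ⁻¹(Y)`: the weak `T[1]`-cluster tilting subcategory `X` with `ℍ(X) = Y`, for those `Y` which
have exactly one such `X` (written, without choice, as the union of all of them). -/
def HPreimage {T : ObjectProperty C} (hT : IsClusterTilting T)
    (Y : ObjectProperty (FPMod k T.FullSubcategory)) : ObjectProperty C :=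
  fun M => ∃ X : ObjectProperty C, IsWeakGhostClusterTilting T X ∧ HImage k hT X = Y ∧ X M

end H

end GhostTilting

/-! Everything is read off a triangle `T₁ ⟶ T₀ ⟶ M ⟶ T₁⟦1⟧` with `T₁` and `T₀` in `T`. Each map from
`M` to an object of `T[1]` factors through `M ⟶ T₁⟦1⟧`, so `[T[1]](M, N[1]) = 0` says exactly that
every map `T₁ ⟶ N` extends to `T₀` (`IsClusterTilting.idealVanishes_iff`). The functor `ℍ` is full,
dense, and faithful on maps out of `T`; it turns the triangle into a projective presentation of `ℍ
M`, and `ℍ T₁ ⟶ ℍ T₀` is mono if and only if the factorization ideal of `M` vanishes. In that case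
`pd ℍ M ≤ 1`, and the same extension property computes `Ext¹(ℍ M, ℍ N) = 0`
(`FactorizationVanishesAt.extOneVanishes_iff`). Hence rigidity relative to `T[1]` corresponds to
(T1), and `T ⊆ X[-1] ∗ X` to (T3).

The inverse map is `HLift`. A module of projective dimension at most one is presented by a map of
`T` whose cone has vanishing factorization ideal (`exists_factorizationVanishesAt`); this uses that
projectives come from `T`, where the Krull-Remak-Schmidt hypothesis enters by splitting idempotents.
`HLift` is rigid and coresolves `T`, which suffices by `isWeakGhostClusterTilting_of_rigid`: any
perpendicular object is a retract of a sum of two objects of the subcategory. Uniqueness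
(`IsWeakTilting.eq_HLift`) holds because `[T[1]](M, N[1]) = 0` depends on `N` only through `ℍ N`.

The second bijection adds contravariant finiteness, which fullness carries to `mod T`. For the
third, cluster tilting subcategories are `F`-stable, and Serre duality upgrades rigidity relative to
`T[1]` to rigidity when `F`-stability holds. -/

namespace GhostTilting

/-! ### Splitting idempotents in Krull-Remak-Schmidt categories -/

section Idempotents

variable {A : Type u} [Category.{v} A] [Preadditive A]

/-- The endomorphism `e` is the idempotent attached to a retract. -/
def SplitsIdem {X : A} (e : X ⟶ X) : Prop :=
  ∃ (Z : A) (i : Z ⟶ X) (p : X ⟶ Z), i ≫ p = 𝟙 Z ∧ p ≫ i = e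

/-- Every idempotent endomorphism of `X` splits, together with its complement. -/
def SplitsIdems (X : A) : Prop :=
  ∀ e : X ⟶ X, e ≫ e = e → SplitsIdem e ∧ SplitsIdem (𝟙 X - e)

lemma SplitsIdems.of_iso {X Y : A} (f : X ≅ Y) (h : SplitsIdems X) : SplitsIdems Y := by
  have key : ∀ e : Y ⟶ Y, SplitsIdem (f.hom ≫ e ≫ f.inv) → SplitsIdem e := by
    rintro e ⟨Z, i, p, h₁, h₂⟩
    refine ⟨Z, i ≫ f.hom, f.inv ≫ p, by simpa using h₁, ?_⟩
    rw [Category.assoc, reassoc_of% h₂]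
    simp
  intro e he
  obtain ⟨h₁, h₂⟩ := h (f.hom ≫ e ≫ f.inv) (by simp [reassoc_of% he])
  exact ⟨key _ h₁, key _ (by simpa using h₂)⟩

section Step

variable {Y X' X : A} {inl : Y ⟶ X} {fst : X ⟶ Y} {inr : X' ⟶ X} {snd : X ⟶ X'}

/-- If an idempotent of `Y ⊕ X'` is invertible on `Y`, it splits as soon as the idempotents of
`X'` do. -/
lemma splitsIdem_of_isUnit [HasBinaryBiproducts A]
    (h₂ : inr ≫ snd = 𝟙 X')
    (h₄ : inr ≫ fst = 0) (ht : fst ≫ inl + snd ≫ inr = 𝟙 X) (hX' : SplitsIdems X')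
    (e : X ⟶ X) (he : e ≫ e = e) (v : Y ⟶ Y) (hv : (inl ≫ e ≫ fst) ≫ v = 𝟙 Y)
    (hv' : v ≫ (inl ≫ e ≫ fst) = 𝟙 Y) : SplitsIdem e ∧ SplitsIdem (𝟙 X - e) := by
  -- `a` and `b` exhibit `Y` as a retract of the image of `e`. Then `c` and `d` exhibit `X'` as the
  -- complement of this copy of `Y`, and `e = b ≫ a + d ≫ (c ≫ e ≫ d) ≫ c`, which reduces the
  -- splitting to `X'`.
  obtain ⟨a, ha⟩ : ∃ a, a = inl ≫ e := ⟨_, rfl⟩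
  obtain ⟨b, hb⟩ : ∃ b, b = e ≫ fst ≫ v := ⟨_, rfl⟩
  have hab : a ≫ b = 𝟙 Y := by
    rw [ha, hb]
    simpa [reassoc_of% he] using hv
  have hae : a ≫ e = a := by rw [ha, Category.assoc, he]
  have heb : e ≫ b = b := by rw [hb, reassoc_of% he]
  obtain ⟨d, hd⟩ : ∃ d, d = snd - fst ≫ v ≫ a ≫ snd := ⟨_, rfl⟩
  obtain ⟨c, hc⟩ : ∃ c, c = inr - inr ≫ b ≫ a := ⟨_, rfl⟩
  have hafst : a ≫ fst ≫ v = 𝟙 Y := by rw [ha]; simpa using hv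
  have hva : v ≫ a ≫ fst = 𝟙 Y := by rw [ha]; simpa using hv'
  have had : a ≫ d = 0 := by
    rw [hd, Preadditive.comp_sub, reassoc_of% hafst, sub_self]
  have hcb : c ≫ b = 0 := by
    rw [hc, Preadditive.sub_comp, Category.assoc, Category.assoc, hab, Category.comp_id, sub_self]
  have hcd : c ≫ d = 𝟙 X' := by
    rw [hc, Preadditive.sub_comp, Category.assoc, Category.assoc, had, comp_zero, comp_zero,
      sub_zero, hd, Preadditive.comp_sub, h₂, reassoc_of% h₄, zero_comp, sub_zero]
  have ht' : snd ≫ inr = 𝟙 X - fst ≫ inl := by rw [← ht]; abel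
  have hdinr : d ≫ inr = 𝟙 X - fst ≫ v ≫ a := by
    rw [hd, Preadditive.sub_comp]
    simp only [Category.assoc, ht', Preadditive.comp_sub, Category.comp_id, reassoc_of% hva]
    abel
  have hdc : d ≫ c = 𝟙 X - b ≫ a := by
    have h : c = inr ≫ (𝟙 X - b ≫ a) := by rw [hc, Preadditive.comp_sub, Category.comp_id]
    rw [h, reassoc_of% hdinr, Preadditive.sub_comp, Category.id_comp, Category.assoc,
      Category.assoc, Preadditive.comp_sub, reassoc_of% hab, Category.comp_id, sub_self,
      comp_zero, comp_zero, sub_zero]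
  have hdcd : ∀ {W : A} (g : X ⟶ W), d ≫ c ≫ g = g - b ≫ a ≫ g := by
    intro W g
    rw [reassoc_of% hdc, Preadditive.sub_comp, Category.id_comp, Category.assoc]
  have hcdr : ∀ {W : A} (g : X' ⟶ W), c ≫ d ≫ g = g := by
    intro W g; rw [reassoc_of% hcd]
  have hebr : ∀ {W : A} (g : Y ⟶ W), e ≫ b ≫ g = b ≫ g := fun g => by rw [reassoc_of% heb]
  have haer : ∀ {W : A} (g : X ⟶ W), a ≫ e ≫ g = a ≫ g := fun g => by rw [reassoc_of% hae]
  have heer : ∀ {W : A} (g : X ⟶ W), e ≫ e ≫ g = e ≫ g := fun g => by rw [reassoc_of% he]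
  have hadr : ∀ {W : A} (g : X' ⟶ W), a ≫ d ≫ g = 0 := fun g => by
    rw [reassoc_of% had, zero_comp]
  have hidem : (c ≫ e ≫ d) ≫ (c ≫ e ≫ d) = c ≫ e ≫ d := by
    simp only [Category.assoc, hdcd, haer, had, heer, comp_zero,
      sub_zero]
  have hded : d ≫ (c ≫ e ≫ d) ≫ c = e - b ≫ a := by
    simp only [Category.assoc, hdcd, hdc, Preadditive.comp_sub, Category.comp_id,
      hebr, hae, reassoc_of% hab]
    abel
  obtain ⟨⟨Z, i, p, hip, hpi⟩, ⟨Z', i', p', hip', hpi'⟩⟩ := hX' _ hidem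
  refine ⟨⟨Y ⊞ Z, biprod.desc a (i ≫ c), biprod.lift b (d ≫ p), ?_, ?_⟩,
    ⟨Z', i' ≫ c, d ≫ p', ?_, ?_⟩⟩
  · ext
    · simpa using hab
    · simpa using hadr p
    · simp [hcb]
    · simp [hcdr, hip]
  · have : p ≫ i ≫ c = (c ≫ e ≫ d) ≫ c := by rw [reassoc_of% hpi]; simp only [Category.assoc]
    rw [biprod.lift_desc, Category.assoc, this, hded]
    abel
  · rw [Category.assoc, hcdr, hip']
  · have : p' ≫ i' ≫ c = (𝟙 X' - c ≫ e ≫ d) ≫ c := by rw [reassoc_of% hpi']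
    rw [Category.assoc, this, Preadditive.sub_comp, Preadditive.comp_sub, hded, Category.id_comp,
      hdc]
    abel

/-- The `Y`-components of `e` and `𝟙 X - e` add up to `1` in a local ring, so one of them is
invertible. Either case may occur, which is why splitting is carried for an idempotent together with
its complement. -/
lemma splitsIdems_of_biproduct [HasBinaryBiproducts A] [IsLocalRing (End Y)]
    (h₁ : inl ≫ fst = 𝟙 Y) (h₂ : inr ≫ snd = 𝟙 X')
    (h₄ : inr ≫ fst = 0) (ht : fst ≫ inl + snd ≫ inr = 𝟙 X) (hX' : SplitsIdems X') :
    SplitsIdems X := by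
  intro e he
  have hsum : (End.of (inl ≫ e ≫ fst) : End Y) + End.of (inl ≫ (𝟙 X - e) ≫ fst) = 1 := by
    change inl ≫ e ≫ fst + inl ≫ (𝟙 X - e) ≫ fst = 𝟙 Y
    simp [h₁]
  rcases IsLocalRing.isUnit_or_isUnit_of_add_one hsum with ⟨u, hu⟩ | ⟨u, hu⟩
  · have hu' : (u : End Y) = inl ≫ e ≫ fst := hu
    refine splitsIdem_of_isUnit h₂ h₄ ht hX' e he (↑u⁻¹ : End Y) ?_ ?_
    · rw [← hu']; exact u.inv_mul
    · rw [← hu']; exact u.mul_inv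
  · have hu' : (u : End Y) = inl ≫ (𝟙 X - e) ≫ fst := hu
    have := splitsIdem_of_isUnit h₂ h₄ ht hX' (𝟙 X - e) (by simp [he]) (↑u⁻¹ : End Y)
      (by rw [← hu']; exact u.inv_mul) (by rw [← hu']; exact u.mul_inv)
    exact ⟨by simpa using this.2, this.1⟩

end Step

lemma splitsIdems_biproduct [HasZeroObject A] [HasFiniteBiproducts A] (n : ℕ) (Y : Fin n → A)
    (hY : ∀ i, IsLocalRing (End (Y i))) : SplitsIdems (⨁ Y) := by
  have : HasBinaryBiproducts A := hasBinaryBiproducts_of_finite_biproducts A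
  induction n with
  | zero =>
    have h0 : 𝟙 (⨁ Y) = 0 := by
      ext j
      exact j.elim0
    intro e _
    have : ∀ e : (⨁ Y) ⟶ ⨁ Y, SplitsIdem e := fun e =>
      ⟨⨁ Y, 𝟙 _, 𝟙 _, by simp, by
        rw [← Category.id_comp e, h0, zero_comp, zero_comp]⟩
    exact ⟨this _, this _⟩
  | succ n ih =>
    have := hY 0
    refine splitsIdems_of_biproduct (inl := biproduct.ι Y 0) (fst := biproduct.π Y 0)
      (X' := ⨁ fun i : Fin n => Y i.succ)
      (inr := biproduct.desc fun i => biproduct.ι Y i.succ)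
      (snd := biproduct.lift fun i => biproduct.π Y i.succ) ?_ ?_ ?_ ?_ (ih _ fun i => hY _)
    · simp
    · ext i j
      simp [biproduct.ι_π]
    · ext i
      simp [biproduct.ι_π_ne Y (Fin.succ_ne_zero i)]
    · refine biproduct.hom_ext' _ _ fun i => ?_
      rw [Preadditive.comp_add, Category.comp_id]
      refine Fin.cases ?_ (fun j => ?_) i
      · have : biproduct.ι Y 0 ≫ (biproduct.lift fun i : Fin n => biproduct.π Y i.succ) = 0 := by
          ext j
          simp [biproduct.ι_π_ne Y (Fin.succ_ne_zero j).symm]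
        simp [reassoc_of% this]
      · have : biproduct.ι Y j.succ ≫ (biproduct.lift fun i : Fin n => biproduct.π Y i.succ) =
            biproduct.ι (fun i : Fin n => Y i.succ) j := by
          ext l
          simp [biproduct.ι_π]
        simp [reassoc_of% this, biproduct.ι_π_ne_assoc Y (Fin.succ_ne_zero j)]

end Idempotents

section

variable {C : Type u} [Category.{v} C] [Preadditive C] [HasZeroObject C] [HasShift C ℤ]
  [∀ n : ℤ, (shiftFunctor C n).Additive] [Pretriangulated C]

lemma IsKrullSchmidt.splitsIdem (hKS : IsKrullSchmidt C) {X : C} (e : X ⟶ X) (he : e ≫ e = e) :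
    SplitsIdem e := by
  obtain ⟨n, Y, hY, ⟨f⟩⟩ := hKS X
  exact (((splitsIdems_biproduct n Y hY).of_iso f.symm) e he).1

end

/-! ### Exactness for explicit distinguished triangles -/

section Triangles

variable {C : Type u} [Category.{v} C] [Preadditive C] [HasZeroObject C] [HasShift C ℤ]
  [∀ n : ℤ, (shiftFunctor C n).Additive] [Pretriangulated C]
  {X Y Z W : C} {f : X ⟶ Y} {g : Y ⟶ Z} {h : Z ⟶ X⟦(1 : ℤ)⟧}

lemma dist_comp₁₂ (hD : Triangle.mk f g h ∈ distTriang C) : f ≫ g = 0 :=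
  comp_distTriang_mor_zero₁₂ _ hD

lemma dist_comp₂₃ (hD : Triangle.mk f g h ∈ distTriang C) : g ≫ h = 0 :=
  comp_distTriang_mor_zero₂₃ _ hD

lemma dist_comp₃₁ (hD : Triangle.mk f g h ∈ distTriang C) : h ≫ f⟦(1 : ℤ)⟧' = 0 :=
  comp_distTriang_mor_zero₃₁ _ hD

lemma dist_desc₂ (hD : Triangle.mk f g h ∈ distTriang C) (u : Y ⟶ W) (hu : f ≫ u = 0) :
    ∃ v : Z ⟶ W, g ≫ v = u := by
  obtain ⟨v, hv⟩ := Triangle.yoneda_exact₂ _ hD u hu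
  exact ⟨v, hv.symm⟩

lemma dist_desc₃ (hD : Triangle.mk f g h ∈ distTriang C) (u : Z ⟶ W) (hu : g ≫ u = 0) :
    ∃ v : X⟦(1 : ℤ)⟧ ⟶ W, h ≫ v = u := by
  obtain ⟨v, hv⟩ := Triangle.yoneda_exact₃ _ hD u hu
  exact ⟨v, hv.symm⟩

lemma dist_lift₁ (hD : Triangle.mk f g h ∈ distTriang C) (u : W ⟶ X⟦(1 : ℤ)⟧)
    (hu : u ≫ f⟦(1 : ℤ)⟧' = 0) : ∃ v : W ⟶ Z, v ≫ h = u := by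
  obtain ⟨v, hv⟩ := Triangle.coyoneda_exact₁ _ hD u hu
  exact ⟨v, hv.symm⟩

lemma dist_lift₂ (hD : Triangle.mk f g h ∈ distTriang C) (u : W ⟶ Y) (hu : u ≫ g = 0) :
    ∃ v : W ⟶ X, v ≫ f = u := by
  obtain ⟨v, hv⟩ := Triangle.coyoneda_exact₂ _ hD u hu
  exact ⟨v, hv.symm⟩

lemma dist_lift₃ (hD : Triangle.mk f g h ∈ distTriang C) (u : W ⟶ Z) (hu : u ≫ h = 0) :
    ∃ v : W ⟶ Y, v ≫ g = u := by
  obtain ⟨v, hv⟩ := Triangle.coyoneda_exact₃ _ hD u hu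
  exact ⟨v, hv.symm⟩

end Triangles

/-! ### Finitely presented functors on `T` as restricted representables -/

section Quotients

variable {k : Type w} [Field k] {B : Type u} [Category.{v} B]

/-- Two pointwise quotients of a functor with the same kernels are isomorphic. -/
lemma nonempty_iso_of_same_kernel {F G G' : B ⥤ ModuleCat.{v} k} (φ : F ⟶ G) (ψ : F ⟶ G')
    (hφ : ∀ X, Function.Surjective (φ.app X).hom) (hψ : ∀ X, Function.Surjective (ψ.app X).hom)
    (h : ∀ X x, (φ.app X).hom x = 0 ↔ (ψ.app X).hom x = 0) :
    ∃ e : G ≅ G', φ ≫ e.hom = ψ := by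
  have hker : ∀ X, LinearMap.ker (φ.app X).hom = LinearMap.ker (ψ.app X).hom := fun X => by
    ext x
    exact h X x
  let e : ∀ X, G.obj X ≃ₗ[k] G'.obj X := fun X =>
    ((φ.app X).hom.quotKerEquivOfSurjective (hφ X)).symm ≪≫ₗ
      Submodule.quotEquivOfEq _ _ (hker X) ≪≫ₗ
        (ψ.app X).hom.quotKerEquivOfSurjective (hψ X)
  have he : ∀ X x, e X ((φ.app X).hom x) = (ψ.app X).hom x := fun X x => by
    have : ((φ.app X).hom.quotKerEquivOfSurjective (hφ X)).symm ((φ.app X).hom x) =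
        Submodule.Quotient.mk x := by
      rw [LinearEquiv.symm_apply_eq]
      rfl
    change (ψ.app X).hom.quotKerEquivOfSurjective (hψ X) (Submodule.quotEquivOfEq _ _ (hker X)
      (((φ.app X).hom.quotKerEquivOfSurjective (hφ X)).symm ((φ.app X).hom x))) = _
    rw [this]
    rfl
  refine ⟨NatIso.ofComponents (fun X => (e X).toModuleIso) ?_, ?_⟩
  · intro X Y f
    ext y
    obtain ⟨x, rfl⟩ := hφ X y
    have h₁ := ConcreteCategory.congr_hom (φ.naturality f) x
    have h₂ := ConcreteCategory.congr_hom (ψ.naturality f) x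
    change e Y ((G.map f).hom ((φ.app X).hom x)) = (G'.map f).hom (e X ((φ.app X).hom x))
    rw [he]
    refine Eq.trans (congrArg (e Y) h₁.symm) ((he Y _).trans h₂)
  · ext X x
    exact he X x

end Quotients

/-! ### Yoneda's lemma, density and fullness for restricted representable functors -/

section H

variable (k : Type w) [Field k] {C : Type u} [Category.{v} C] [Preadditive C] [Linear k C]
  {T : ObjectProperty C}

variable {k} in
/-- The action of a transformation out of a restricted representable functor on a morphism. -/
def evalAt {M : C} {F : T.FullSubcategoryᵒᵖ ⥤ ModuleCat.{v} k}
    (φ : (restrictedYoneda k T).obj M ⟶ F) (X : T.FullSubcategory) (x : X.obj ⟶ M) :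
    F.obj (Opposite.op X) :=
  (φ.app (Opposite.op X)).hom x

variable {k} in
lemma evalAt_comp {M : C} {F : T.FullSubcategoryᵒᵖ ⥤ ModuleCat.{v} k}
    (φ : (restrictedYoneda k T).obj M ⟶ F) {X Y : T.FullSubcategory} (a : Y.obj ⟶ X.obj)
    (x : X.obj ⟶ M) :
    evalAt φ Y (a ≫ x) = (F.map (ObjectProperty.homMk a : Y ⟶ X).op).hom (evalAt φ X x) :=
  ConcreteCategory.congr_hom (φ.naturality (ObjectProperty.homMk a : Y ⟶ X).op) x

variable {k} in
lemma evalAt_zero {M : C} {F : T.FullSubcategoryᵒᵖ ⥤ ModuleCat.{v} k}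
    (φ : (restrictedYoneda k T).obj M ⟶ F) (X : T.FullSubcategory) :
    evalAt φ X 0 = 0 :=
  (φ.app (Opposite.op X)).hom.map_zero

variable {k} in
lemma evalAt_comp_hom {M : C} {F G : T.FullSubcategoryᵒᵖ ⥤ ModuleCat.{v} k}
    (φ : (restrictedYoneda k T).obj M ⟶ F) (ψ : F ⟶ G) (X : T.FullSubcategory)
    (x : X.obj ⟶ M) :
    evalAt (φ ≫ ψ) X x = (ψ.app (Opposite.op X)).hom (evalAt φ X x) :=
  rfl

lemma evalAt_map {M N : C} (f : M ⟶ N) (X : T.FullSubcategory) (x : X.obj ⟶ M) :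
    evalAt ((restrictedYoneda k T).map f) X x = x ≫ f :=
  rfl

variable {k} in
lemma evalAt_ext {M : C} {F : T.FullSubcategoryᵒᵖ ⥤ ModuleCat.{v} k}
    {φ ψ : (restrictedYoneda k T).obj M ⟶ F}
    (h : ∀ (X : T.FullSubcategory) (x : X.obj ⟶ M), evalAt φ X x = evalAt ψ X x) : φ = ψ := by
  ext X x
  exact h X.unop x

/-- Restricted representable functors are faithful on morphisms out of objects of `T`. -/
lemma restrictedYoneda_map_injective {X M : C} (hX : T X) {f g : X ⟶ M}
    (h : (restrictedYoneda k T).map f = (restrictedYoneda k T).map g) : f = g := by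
  have := congrArg (fun φ => evalAt φ ⟨X, hX⟩ (𝟙 X)) h
  exact (Category.id_comp f).symm.trans (Eq.trans this (Category.id_comp g))

variable {k} in
/-- Yoneda's lemma, existence part. -/
lemma exists_evalAt_eq {F : T.FullSubcategoryᵒᵖ ⥤ ModuleCat.{v} k}
    (hF : IsFinPresModule k T.FullSubcategory F) (X : T.FullSubcategory)
    (m : F.obj (Opposite.op X)) :
    ∃ φ : (restrictedYoneda k T).obj X.obj ⟶ F, evalAt φ X (𝟙 X.obj) = m := by
  have := hF.additive
  let φ : (restrictedYoneda k T).obj X.obj ⟶ F :=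
    { app := fun Y => ModuleCat.ofHom
        { toFun := fun f : Y.unop.obj ⟶ X.obj =>
            (F.map (ObjectProperty.homMk f : Y.unop ⟶ X).op).hom m
          map_add' := fun f g => by
            have : (ObjectProperty.homMk (f + g) : Y.unop ⟶ X).op =
              (ObjectProperty.homMk f : Y.unop ⟶ X).op + (ObjectProperty.homMk g : Y.unop ⟶ X).op :=
              rfl
            rw [this, Functor.map_add]
            rfl
          map_smul' := fun r f => by
            have : (ObjectProperty.homMk (r • f) : Y.unop ⟶ X) =
              r • (ObjectProperty.homMk f : Y.unop ⟶ X) := rfl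
            rw [this, hF.linear]
            rfl }
      naturality := fun Y Z f => by
        ext y
        let y' : Y.unop.obj ⟶ X.obj := y
        have : (ObjectProperty.homMk (f.unop.hom ≫ y') : Z.unop ⟶ X).op =
          (ObjectProperty.homMk y' : Y.unop ⟶ X).op ≫ f := rfl
        change (F.map (ObjectProperty.homMk (f.unop.hom ≫ y') : Z.unop ⟶ X).op).hom m = _
        rw [this, F.map_comp]
        rfl }
  refine ⟨φ, ?_⟩
  have : (ObjectProperty.homMk (𝟙 X.obj) : X ⟶ X).op = 𝟙 _ := rfl
  change (F.map (ObjectProperty.homMk (𝟙 X.obj) : X ⟶ X).op).hom m = m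
  rw [this, F.map_id]
  rfl

lemma IsFinPresModule.of_iso {A : Type u} [Category.{v} A] [Preadditive A] [Linear k A]
    {F G : Aᵒᵖ ⥤ ModuleCat.{v} k} (e : F ≅ G)
    (hF : IsFinPresModule k A F) : IsFinPresModule k A G := by
  have := hF.additive
  refine ⟨Functor.additive_of_iso e, fun r f => ?_, ?_⟩
  · rw [← cancel_epi (e.hom.app _), ← e.hom.naturality, hF.linear, Linear.comp_smul,
      ← e.hom.naturality, Linear.smul_comp]
  · obtain ⟨A₁, A₀, f, g, h⟩ := hF.presentation
    refine ⟨A₁, A₀, f, g ≫ e.hom, fun X => ?_⟩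
    let eX := (e.app X).toLinearEquiv
    have hg : ∀ x, ((g ≫ e.hom).app X).hom x = eX ((g.app X).hom x) := fun x => rfl
    refine ⟨fun y => ?_, fun y => ?_⟩
    · rw [hg, ← (h X).1 y, LinearEquiv.map_eq_zero_iff]
    · obtain ⟨x, hx⟩ := (h X).2 (eX.symm y)
      exact ⟨x, by rw [hg, hx, LinearEquiv.apply_symm_apply]⟩

variable [HasZeroObject C] [HasShift C ℤ] [∀ n : ℤ, (shiftFunctor C n).Additive]
  [Pretriangulated C]

/-- Every object has a two-term resolution by a cluster tilting subcategory. -/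
lemma IsClusterTilting.exists_triangle (hT : IsClusterTilting T) (M : C) :
    ∃ (T₁ T₀ : C) (i : T₁ ⟶ T₀) (p : T₀ ⟶ M) (q : M ⟶ T₁⟦(1 : ℤ)⟧), T T₁ ∧ T T₀ ∧
      Triangle.mk i p q ∈ distTriang C := by
  obtain ⟨T₀, p, hT₀, hp⟩ := hT.contravariantlyFinite M
  obtain ⟨T₁, i, q, hD⟩ := distinguished_cocone_triangle₁ p
  refine ⟨T₁, T₀, i, p, q, ?_, hT₀, hD⟩
  rw [hT.mem_iff_right]
  intro X hX f
  have h1 : f ≫ i⟦(1 : ℤ)⟧' = 0 := (hT.mem_iff_right T₀).1 hT₀ X hX _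
  obtain ⟨g, hg⟩ := dist_lift₁ hD f h1
  obtain ⟨h, hh⟩ := hp X hX g
  rw [← hg, ← hh, Category.assoc, dist_comp₂₃ hD, comp_zero]

/-- A two-term resolution by a cluster tilting subcategory gives a right approximation. -/
lemma IsClusterTilting.exists_lift (hT : IsClusterTilting T) {T₁ T₀ M : C} {i : T₁ ⟶ T₀}
    {p : T₀ ⟶ M} {q : M ⟶ T₁⟦(1 : ℤ)⟧} (h₁ : T T₁) (hD : Triangle.mk i p q ∈ distTriang C) {X : C}
    (hX : T X) (x : X ⟶ M) : ∃ y : X ⟶ T₀, y ≫ p = x :=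
  dist_lift₃ hD x ((hT.mem_iff_right T₁).1 h₁ X hX _)

/-- A pointwise quotient of a restricted representable functor by the image of `t : N ⟶ M` with
`N ∈ T` is a restricted representable functor. -/
lemma exists_iso_restrictedYoneda_of_quotient (hT : IsClusterTilting T) {M N : C} (t : N ⟶ M)
    (hN : T N) {F : T.FullSubcategoryᵒᵖ ⥤ ModuleCat.{v} k}
    (φ : (restrictedYoneda k T).obj M ⟶ F)
    (hφ : ∀ X, Function.Surjective (evalAt φ X))
    (h : ∀ (X : T.FullSubcategory) (x : X.obj ⟶ M), evalAt φ X x = 0 ↔ ∃ y : X.obj ⟶ N, y ≫ t = x) :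
    ∃ Z, Nonempty ((restrictedYoneda k T).obj Z ≅ F) := by
  obtain ⟨Z, z, r, hD⟩ := distinguished_cocone_triangle t
  obtain ⟨e, -⟩ := nonempty_iso_of_same_kernel ((restrictedYoneda k T).map z) φ
    (fun X x => hT.exists_lift hN hD X.unop.property x)
    (fun X => hφ X.unop) (fun X x => by
      refine Iff.trans ?_ (h X.unop x).symm
      constructor
      · exact fun hx => dist_lift₂ hD x hx
      · rintro ⟨y, hy⟩
        change x ≫ z = 0
        rw [← hy, Category.assoc, dist_comp₁₂ hD, comp_zero])
  exact ⟨Z, ⟨e⟩⟩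

/-- A presentation is a map of `T`, and the cone of that map represents the cokernel on `T` because
`Hom(T, T[1]) = 0`. -/
lemma isFinPresModule_iff (hT : IsClusterTilting T) (F : T.FullSubcategoryᵒᵖ ⥤ ModuleCat.{v} k) :
    IsFinPresModule k T.FullSubcategory F ↔ ∃ Z, Nonempty ((restrictedYoneda k T).obj Z ≅ F) := by
  constructor
  · intro hF
    obtain ⟨A₁, A₀, f, g, h⟩ := hF.presentation
    let φ : (restrictedYoneda k T).obj A₀.obj ⟶ F :=
      { app := fun X => ModuleCat.ofHom
          { toFun := fun x : X.unop.obj ⟶ A₀.obj =>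
              (g.app X).hom (ObjectProperty.homMk x : X.unop ⟶ A₀)
            map_add' := fun x y =>
              (g.app X).hom.map_add (ObjectProperty.homMk x : X.unop ⟶ A₀)
                (ObjectProperty.homMk y : X.unop ⟶ A₀)
            map_smul' := fun r x =>
              (g.app X).hom.map_smul r (ObjectProperty.homMk x : X.unop ⟶ A₀) }
        naturality := fun X Y a => by
          ext x
          exact ConcreteCategory.congr_hom (g.naturality a)
            (ObjectProperty.homMk (show X.unop.obj ⟶ A₀.obj from x) : X.unop ⟶ A₀) }
    have hφ : ∀ (X : T.FullSubcategory) (x : X ⟶ A₀),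
      evalAt φ X x.hom = (g.app (Opposite.op X)).hom x := fun X x => rfl
    let t : A₁ ⟶ A₀ := (f.app (Opposite.op A₁)).hom (𝟙 A₁)
    have ht : ∀ (X : T.FullSubcategory) (x : X ⟶ A₁), (f.app (Opposite.op X)).hom x = x ≫ t := by
      intro X x
      have := ConcreteCategory.congr_hom (f.naturality x.op) (𝟙 A₁)
      refine Eq.trans ?_ this
      exact congrArg (f.app (Opposite.op X)).hom (Category.comp_id x).symm
    refine exists_iso_restrictedYoneda_of_quotient k hT t.hom A₁.property φ ?_ ?_
    · intro X m
      obtain ⟨x, hx⟩ := (h (Opposite.op X)).2 m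
      exact ⟨InducedCategory.Hom.hom x, hx⟩
    · intro X x
      refine ((h (Opposite.op X)).1 (ObjectProperty.homMk x : X ⟶ A₀)).trans ?_
      constructor
      · rintro ⟨y, hy⟩
        refine ⟨InducedCategory.Hom.hom y, ?_⟩
        exact congrArg InducedCategory.Hom.hom ((ht X y).symm.trans hy)
      · rintro ⟨y, hy⟩
        refine ⟨(ObjectProperty.homMk y : X ⟶ A₁), ?_⟩
        exact (ht X _).trans (ObjectProperty.hom_ext _ hy)
  · rintro ⟨Z, ⟨e⟩⟩
    exact .of_iso k e (restrictedYoneda_finPres k hT Z)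

/-- By Yoneda, `φ` sends `p : T₀ ⟶ M` to a map `T₀ ⟶ N` killed by `i`, which therefore descends to
`M`. Every map from `T` to `M` factors through `p`, so this descent induces `φ`. -/
lemma restrictedYoneda_full (hT : IsClusterTilting T) : (restrictedYoneda k T).Full where
  map_surjective := by
    intro M N φ
    obtain ⟨T₁, T₀, i, p, q, h₁, h₀, hD⟩ := hT.exists_triangle M
    have hip : i ≫ p = 0 := dist_comp₁₂ hD
    have hi : i ≫ evalAt φ ⟨T₀, h₀⟩ p = 0 := by
      have := evalAt_comp φ (X := ⟨T₀, h₀⟩) (Y := ⟨T₁, h₁⟩) i p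
      rw [hip, evalAt_zero] at this
      exact this.symm
    obtain ⟨f, hf⟩ := dist_desc₂ hD _ hi
    refine ⟨f, evalAt_ext fun X x => ?_⟩
    obtain ⟨y, rfl⟩ := hT.exists_lift h₁ hD X.property x
    rw [evalAt_map, evalAt_comp φ (X := ⟨T₀, h₀⟩) (Y := X) y p, Category.assoc]
    exact congrArg (y ≫ ·) hf

end H

/-! ### The category of finitely presented `T`-modules is abelian -/

/-- The image of a subcategory with finite products under an additive functor is closed under
finite products. -/
lemma isClosedUnderFiniteProducts_map {A : Type*} [Category* A] [Preadditive A]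
    [HasFiniteProducts A] {B : Type*} [Category* B] [Preadditive B] (F : A ⥤ B) [F.Additive]
    (P : ObjectProperty A) [P.IsClosedUnderFiniteProducts] :
    (P.map F).IsClosedUnderFiniteProducts where
  isClosedUnderLimitsOfShape J _ := ⟨by
    rintro Y ⟨p⟩
    choose X hX e using p.prop_diag_obj
    let G : Discrete J ⥤ A := Discrete.functor fun j => X ⟨j⟩
    let α : G ⋙ F ≅ p.diag := Discrete.natIso fun j => (e j).some
    refine ⟨limit G, P.prop_of_isLimit (limit.isLimit G) fun j => hX j, ⟨?_⟩⟩
    exact ((isLimitOfPreserves F (limit.isLimit G)).conePointsIsoOfNatIso p.isLimit α)⟩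

section H

variable (k : Type w) [Field k] {C : Type u} [Category.{v} C] [Preadditive C] [Linear k C]
  {T : ObjectProperty C}

lemma restrictedYoneda_additive : (restrictedYoneda k T).Additive where
  map_add {_ _ f g} := evalAt_ext fun _ x => Preadditive.comp_add _ _ _ x f g

lemma functor_exact_apply {A : Type u} [Category.{v} A] {S : ShortComplex (A ⥤ ModuleCat.{v} k)}
    (hS : S.Exact) (X : A) (x : S.X₂.obj X) (hx : (S.g.app X).hom x = 0) :
    ∃ y, (S.f.app X).hom y = x :=
  (ShortComplex.moduleCat_exact_iff _).1 (hS.map ((evaluation _ _).obj X)) x hx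

variable [HasZeroObject C] [HasShift C ℤ] [∀ n : ℤ, (shiftFunctor C n).Additive]
  [Pretriangulated C]

/-- As the image of an additive functor on all of `C`, `mod T` inherits finite products from `C`. -/
lemma isFinPresModule_eq (hT : IsClusterTilting T) :
    (fun F => IsFinPresModule k T.FullSubcategory F) =
      (⊤ : ObjectProperty C).map (restrictedYoneda k T) := by
  ext F
  rw [isFinPresModule_iff k hT]
  exact ⟨fun ⟨Z, e⟩ => ⟨Z, trivial, e⟩, fun ⟨Z, _, e⟩ => ⟨Z, e⟩⟩

lemma finPres_isClosedUnderFiniteProducts (hT : IsClusterTilting T) :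
    ObjectProperty.IsClosedUnderFiniteProducts
      (fun F => IsFinPresModule k T.FullSubcategory F) := by
  have := restrictedYoneda_additive k (T := T)
  rw [isFinPresModule_eq k hT]
  have : (⊤ : ObjectProperty C).IsClosedUnderFiniteProducts := ⟨fun _ _ => ⟨fun _ _ => trivial⟩⟩
  exact isClosedUnderFiniteProducts_map _ _

lemma finPres_containsZero (hT : IsClusterTilting T) :
    ObjectProperty.ContainsZero (fun F => IsFinPresModule k T.FullSubcategory F) where
  exists_zero := by
    have := restrictedYoneda_additive k (T := T)
    obtain ⟨Z, hZ⟩ := HasZeroObject.zero (C := C)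
    exact ⟨_, (restrictedYoneda k T).map_isZero hZ, restrictedYoneda_finPres k hT Z⟩

/-- A finitely presented functor is a quotient of a representable one. -/
lemma IsFinPresModule.exists_cover (hT : IsClusterTilting T)
    {F : T.FullSubcategoryᵒᵖ ⥤ ModuleCat.{v} k} (hF : IsFinPresModule k T.FullSubcategory F) :
    ∃ (X : C) (_ : T X) (φ : (restrictedYoneda k T).obj X ⟶ F),
      ∀ Y, Function.Surjective (evalAt φ Y) := by
  obtain ⟨M, ⟨e⟩⟩ := (isFinPresModule_iff k hT F).1 hF
  obtain ⟨T₁, T₀, i, p, q, h₁, h₀, hD⟩ := hT.exists_triangle M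
  refine ⟨T₀, h₀, (restrictedYoneda k T).map p ≫ e.hom, fun Y y => ?_⟩
  obtain ⟨x, hx⟩ := hT.exists_lift h₁ hD Y.property
    ((e.app (Opposite.op Y)).toLinearEquiv.symm y)
  refine ⟨x, ?_⟩
  rw [evalAt_comp_hom, evalAt_map, hx]
  exact (e.app (Opposite.op Y)).toLinearEquiv.apply_symm_apply y

lemma finPres_isClosedUnderCokernels (hT : IsClusterTilting T) :
    ObjectProperty.IsClosedUnderCokernels
      (fun F => IsFinPresModule k T.FullSubcategory F) where
  cokernels_le := by
    rintro _ ⟨f, c, hc, hF, hG⟩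
    rename_i F G
    obtain ⟨M, ⟨e⟩⟩ := (isFinPresModule_iff k hT G).1 hG
    obtain ⟨X, hX, φ, hφ⟩ := IsFinPresModule.exists_cover k hT hF
    have hcπ : Epi c.π := epi_of_isColimit_cofork hc
    let S := ShortComplex.mk f c.π c.condition
    have hS : S.Exact := S.exact_of_g_is_cokernel
      (IsColimit.ofIsoColimit hc (Cofork.ext (Iso.refl _) (by simp [S])))
    -- After covering `F` by an object `X` of `T`, the map `f` becomes `t : X ⟶ M`; the cone of `t`
    -- then represents the cokernel.
    obtain ⟨t, ht⟩ := (restrictedYoneda_full k hT).map_surjective (φ ≫ f ≫ e.inv)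
    have ht' : ∀ (Y : T.FullSubcategory) (y : Y.obj ⟶ X), evalAt e.hom Y (y ≫ t) =
        (f.app (Opposite.op Y)).hom (evalAt φ Y y) := by
      have : (restrictedYoneda k T).map t ≫ e.hom = φ ≫ f := by simp [ht]
      exact fun Y y => congrArg (fun ψ => evalAt ψ Y y) this
    have heinj : ∀ (Y : T.FullSubcategory), Function.Bijective (evalAt e.hom Y) := fun Y =>
      (e.app (Opposite.op Y)).toLinearEquiv.bijective
    refine (isFinPresModule_iff k hT _).2 (exists_iso_restrictedYoneda_of_quotient k hT t hX
      (e.hom ≫ c.π) ?_ ?_)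
    · intro Y y
      have := (ModuleCat.epi_iff_surjective _).1
        (inferInstance : Epi (c.π.app (Opposite.op Y)))
      obtain ⟨z, hz⟩ := this y
      obtain ⟨x, rfl⟩ := (heinj Y).2 z
      exact ⟨x, hz⟩
    · intro Y x
      rw [evalAt_comp_hom]
      constructor
      · intro hx
        obtain ⟨y, hy⟩ := functor_exact_apply k hS (Opposite.op Y) _ hx
        obtain ⟨y, rfl⟩ := hφ Y y
        exact ⟨y, (heinj Y).1 ((ht' Y y).trans hy)⟩
      · rintro ⟨y, rfl⟩
        rw [ht']
        exact ConcreteCategory.congr_hom (congr_app c.condition (Opposite.op Y)) _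

lemma finPres_isClosedUnderKernels (hT : IsClusterTilting T) :
    ObjectProperty.IsClosedUnderKernels
      (fun F => IsFinPresModule k T.FullSubcategory F) where
  kernels_le := by
    rintro _ ⟨f, c, hc, hF, hG⟩
    rename_i F G
    obtain ⟨M, ⟨e⟩⟩ := (isFinPresModule_iff k hT F).1 hF
    obtain ⟨N, ⟨e'⟩⟩ := (isFinPresModule_iff k hT G).1 hG
    have hcι : Mono c.ι := mono_of_isLimit_fork hc
    obtain ⟨g, hg⟩ := (restrictedYoneda_full k hT).map_surjective (e.hom ≫ f ≫ e'.inv)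
    obtain ⟨L, l, r, hD⟩ := distinguished_cocone_triangle₁ g
    have hl : ((restrictedYoneda k T).map l ≫ e.hom) ≫ f = 0 := by
      rw [← cancel_mono e'.inv, Category.assoc, Category.assoc, ← hg, zero_comp]
      exact evalAt_ext fun X x => by
        change (x ≫ l) ≫ g = 0
        rw [Category.assoc, dist_comp₁₂ hD, comp_zero]
    obtain ⟨φ, hφ⟩ : ∃ φ : (restrictedYoneda k T).obj L ⟶ c.pt,
        φ ≫ c.ι = (restrictedYoneda k T).map l ≫ e.hom :=
      ⟨hc.lift (KernelFork.ofι _ hl), Fork.IsLimit.lift_ι hc⟩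
    have hbij : ∀ (Y : T.FullSubcategory), Function.Bijective (evalAt e.hom Y) := fun Y =>
      (e.app (Opposite.op Y)).toLinearEquiv.bijective
    have hbij' : ∀ (Y : T.FullSubcategory), Function.Bijective (evalAt e'.hom Y) := fun Y =>
      (e'.app (Opposite.op Y)).toLinearEquiv.bijective
    have hinj : ∀ (Y : T.FullSubcategory), Function.Injective (c.ι.app (Opposite.op Y)).hom :=
      fun Y => (ModuleCat.mono_iff_injective _).1
        (inferInstance : Mono (c.ι.app (Opposite.op Y)))
    have hφ' : ∀ (Y : T.FullSubcategory) (x : Y.obj ⟶ L), (c.ι.app (Opposite.op Y)).hom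
        (evalAt φ Y x) = evalAt e.hom Y (x ≫ l) := fun Y x =>
      congrArg (fun ψ => evalAt ψ Y x) hφ
    have hg' : ∀ (Y : T.FullSubcategory) (x : Y.obj ⟶ M), evalAt e'.hom Y (x ≫ g) =
        (f.app (Opposite.op Y)).hom (evalAt e.hom Y x) := by
      have : (restrictedYoneda k T).map g ≫ e'.hom = e.hom ≫ f := by simp [hg]
      exact fun Y x => congrArg (fun ψ => evalAt ψ Y x) this
    have hsurj : ∀ Y, Function.Surjective (evalAt φ Y) := by
      intro Y y
      obtain ⟨x, hx⟩ := (hbij Y).2 ((c.ι.app (Opposite.op Y)).hom y)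
      have hxg : x ≫ g = 0 := by
        apply (hbij' Y).1
        rw [hg', hx, evalAt_zero]
        exact ConcreteCategory.congr_hom (congr_app c.condition (Opposite.op Y)) y
      obtain ⟨z, hz⟩ := dist_lift₂ hD x hxg
      exact ⟨z, hinj Y ((hφ' Y z).trans (by rw [hz, hx]))⟩
    -- `ℍ L` only surjects onto the kernel. Covering `L` by `L₀` in `T`, and the fibre `K` of `L₀ ⟶
    -- M` by `K₀` in `T`, gives a presentation of the kernel by `K₀ ⟶ L₀`.
    obtain ⟨L₁, L₀, i, p, q, h₁, h₀, hL⟩ := hT.exists_triangle L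
    obtain ⟨K, t, s, hK⟩ := distinguished_cocone_triangle₁ (p ≫ l)
    obtain ⟨K₁, K₀, i', p', q', hK₁, hK₀, hK'⟩ := hT.exists_triangle K
    refine (isFinPresModule_iff k hT _).2 (exists_iso_restrictedYoneda_of_quotient k hT
      (p' ≫ t) hK₀ ((restrictedYoneda k T).map p ≫ φ) ?_ ?_)
    · intro Y y
      obtain ⟨x, rfl⟩ := hsurj Y y
      obtain ⟨z, rfl⟩ := hT.exists_lift h₁ hL Y.property x
      exact ⟨z, rfl⟩
    · intro Y x
      have key : evalAt ((restrictedYoneda k T).map p ≫ φ) Y x = 0 ↔ x ≫ p ≫ l = 0 := by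
        have h : evalAt ((restrictedYoneda k T).map p ≫ φ) Y x = evalAt φ Y (x ≫ p) := rfl
        rw [h]
        constructor
        · intro hx
          apply (hbij Y).1
          rw [evalAt_zero, ← Category.assoc, ← hφ' Y, hx, map_zero]
        · intro hx
          apply hinj Y
          rw [hφ', Category.assoc, hx, evalAt_zero, map_zero]
      rw [key]
      constructor
      · intro hx
        obtain ⟨y, hy⟩ := dist_lift₂ hK x hx
        obtain ⟨z, rfl⟩ := hT.exists_lift hK₁ hK' Y.property y
        exact ⟨z, by rw [← hy, Category.assoc]⟩
      · rintro ⟨y, rfl⟩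
        simp only [Category.assoc]
        rw [dist_comp₁₂ hK, comp_zero, comp_zero]

/-- The category `mod T` is abelian when `T` is cluster tilting. -/
noncomputable abbrev fpModAbelian (hT : IsClusterTilting T) :
    Abelian (FPMod k T.FullSubcategory) :=
  have := finPres_containsZero k hT
  have := finPres_isClosedUnderKernels k hT
  have := finPres_isClosedUnderCokernels k hT
  have := finPres_isClosedUnderFiniteProducts k hT
  inferInstance

end H

/-! ### Homological algebra in abelian categories -/

section Abelian

variable {A : Type u} [Category.{v} A] [Abelian A]

/-- Vanishing of `Ext¹` in terms of a projective presentation. -/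
lemma extOneVanishes_iff {P₁ P₀ M N : A} {i : P₁ ⟶ P₀} {p : P₀ ⟶ M} {zero : i ≫ p = 0}
    (hS : (ShortComplex.mk i p zero).ShortExact) (hP₀ : Projective P₀) :
    ExtOneVanishes M N ↔ ∀ a : P₁ ⟶ N, ∃ b : P₀ ⟶ N, i ≫ b = a := by
  have := hS.mono_f
  have := hS.epi_g
  dsimp at *
  constructor
  · intro h a
    have w : a ≫ (0 : N ⟶ M) = i ≫ p := by rw [comp_zero, zero]
    -- The extension attached to `a` is the pushout of the presentation along `a`; a retraction onto
    -- `N`, restricted to `P₀`, extends `a`.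
    let q : pushout a i ⟶ M := pushout.desc 0 p w
    have hq₁ : pushout.inl a i ≫ q = 0 := pushout.inl_desc _ _ _
    have hq₂ : pushout.inr a i ≫ q = p := pushout.inr_desc _ _ _
    have : Epi q := epi_of_epi_fac hq₂
    have hex : (ShortComplex.mk (pushout.inl a i) q hq₁).Exact := by
      refine ShortComplex.exact_of_g_is_cokernel _
        (CokernelCofork.IsColimit.ofπ' _ _ fun {W} g hg => ?_)
      have hg' : i ≫ pushout.inr a i ≫ g = 0 := by
        rw [← pushout.condition_assoc, hg, comp_zero]
      refine ⟨hS.exact.desc (pushout.inr a i ≫ g) hg', ?_⟩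
      apply pushout.hom_ext
      · rw [reassoc_of% hq₁, zero_comp, hg]
      · rw [reassoc_of% hq₂]
        exact hS.exact.g_desc _ _
    have hE : (ShortComplex.mk (pushout.inl a i) q hq₁).ShortExact :=
      { exact := hex
        mono_f := (inferInstance : Mono (pushout.inl a i))
        epi_g := this }
    obtain ⟨s⟩ := h _ _ _ _ hE
    refine ⟨pushout.inr a i ≫ s.r, ?_⟩
    rw [← pushout.condition_assoc]
    exact (congrArg (a ≫ ·) s.f_r).trans (Category.comp_id a)
  · intro h E j q zero' hE
    have := hE.mono_f
    have := hE.epi_g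
    dsimp at *
    let l : P₀ ⟶ E := Projective.factorThru p q
    have hl : l ≫ q = p := Projective.factorThru_comp p q
    obtain ⟨a, ha⟩ : ∃ a : P₁ ⟶ N, a ≫ j = i ≫ l :=
      ⟨hE.exact.lift (i ≫ l) (by simp [hl, zero]), hE.exact.lift_f _ _⟩
    obtain ⟨b, hb⟩ := h a
    -- Correcting the lift `l` by the extension `b` makes it vanish on `P₁`, so it descends to a
    -- section of `q`.
    obtain ⟨s, hs⟩ := hS.exact.desc' (l - b ≫ j) (by
      simp [← ha, ← hb])
    exact ⟨ShortComplex.Splitting.ofExactOfSection _ hE.exact s (by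
      rw [← cancel_epi p]
      dsimp at hs ⊢
      rw [reassoc_of% hs]
      simp [hl, zero']) hE.mono_f⟩

/-- Pull the extension back along the retraction `M ⟶ M'`; a section over `M`, precomposed with the
inclusion of `M'`, gives a section of the original. -/
lemma ExtOneVanishes.of_retract {M M' N N' : A} (h : ExtOneVanishes M N) (r : Retract M' M)
    (e : N ≅ N') : ExtOneVanishes M' N' := by
  intro E j q zero hE
  have := hE.mono_f
  have := hE.epi_g
  dsimp at *
  have hj : (e.hom ≫ j) ≫ q = 0 := by rw [Category.assoc, zero, comp_zero]
  have : Mono (pullback.lift 0 (e.hom ≫ j) (by rw [zero_comp, hj]) : N ⟶ pullback r.r q) :=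
    mono_of_mono_fac (pullback.lift_snd _ _ _)
  have hex : (ShortComplex.mk (pullback.lift 0 (e.hom ≫ j) (by rw [zero_comp, hj]))
      (pullback.fst r.r q) (pullback.lift_fst _ _ _)).Exact := by
    refine ShortComplex.exact_of_f_is_kernel _ (KernelFork.IsLimit.ofι' _ _ fun {W} x hx => ?_)
    refine ⟨hE.exact.lift (x ≫ pullback.snd r.r q) ?_ ≫ e.inv, ?_⟩
    · dsimp
      rw [Category.assoc, ← pullback.condition, reassoc_of% hx, zero_comp]
    · apply pullback.hom_ext
      · rw [Category.assoc, pullback.lift_fst, comp_zero, hx]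
      · rw [Category.assoc, pullback.lift_snd, Category.assoc, e.inv_hom_id_assoc]
        exact hE.exact.lift_f _ _
  obtain ⟨s⟩ := h _ _ _ _
    { exact := hex
      mono_f := this
      epi_g := (inferInstance : Epi (pullback.fst r.r q)) }
  refine ⟨ShortComplex.Splitting.ofExactOfSection _ hE.exact (r.i ≫ s.s ≫ pullback.snd r.r q) ?_
    hE.mono_f⟩
  have hs : s.s ≫ pullback.fst r.r q = 𝟙 M := s.s_g
  dsimp
  rw [Category.assoc, Category.assoc, ← pullback.condition, reassoc_of% hs, r.retract]

/-- This form passes to retracts and is independent of the resolution chosen. -/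
lemma ProjDimLEOne.hasProjectiveDimensionLT {M : A} (h : ProjDimLEOne M) :
    HasProjectiveDimensionLT M 2 := by
  obtain ⟨P₁, P₀, i, p, zero, h₁, h₀, hS⟩ := h
  exact hS.hasProjectiveDimensionLT_X₃ 1 (projective_iff_hasProjectiveDimensionLT_one.1 h₁)
    (inferInstanceAs (HasProjectiveDimensionLT P₀ (1 + 1)))

/-- If `M` has projective dimension at most one, then the kernel of any epimorphism from a
projective object to `M` is projective. -/
lemma projective_kernel {M P₀ : A} [HasProjectiveDimensionLT M 2] (p : P₀ ⟶ M) [Epi p]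
    [Projective P₀] : Projective (kernel p) := by
  have hS : (ShortComplex.mk (kernel.ι p) p (kernel.condition p)).ShortExact :=
    { exact := ShortComplex.exact_of_f_is_kernel _ (kernelIsKernel p)
      mono_f := (inferInstance : Mono (kernel.ι p))
      epi_g := ‹_› }
  exact projective_iff_hasProjectiveDimensionLT_one.2
    ((hS.hasProjectiveDimensionLT_X₃_iff 0 ‹_›).1 ‹_›)

end Abelian

/-! ### Properties of the functor `ℍ` -/

section H

variable (k : Type w) [Field k] {C : Type u} [Category.{v} C] [Preadditive C] [Linear k C]
  {T : ObjectProperty C} [HasZeroObject C] [HasShift C ℤ] [∀ n : ℤ, (shiftFunctor C n).Additive]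
  [Pretriangulated C] (hT : IsClusterTilting T)

include hT

lemma HFunctor_full : (HFunctor k hT).Full :=
  have := restrictedYoneda_full k hT
  inferInstanceAs (ObjectProperty.lift _ _ _).Full

lemma HFunctor_additive : (HFunctor k hT).Additive where
  map_add := ObjectProperty.hom_ext _ ((restrictedYoneda_additive k).map_add)

lemma HFunctor_map_injective {X M : C} (hX : T X) {f g : X ⟶ M}
    (h : (HFunctor k hT).map f = (HFunctor k hT).map g) : f = g :=
  restrictedYoneda_map_injective k hX (congrArg (fun φ => φ.hom) h)

lemma HFunctor_exists_iso (F : FPMod k T.FullSubcategory) :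
    ∃ M, Nonempty ((HFunctor k hT).obj M ≅ F) := by
  obtain ⟨M, ⟨e⟩⟩ := (isFinPresModule_iff k hT F.obj).1 F.property
  exact ⟨M, ⟨ObjectProperty.isoMk _ e⟩⟩

lemma HFunctor_exists_cover (F : FPMod k T.FullSubcategory) :
    ∃ (X : C) (_ : T X) (φ : (HFunctor k hT).obj X ⟶ F), Epi φ := by
  obtain ⟨X, hX, φ, hφ⟩ := IsFinPresModule.exists_cover k hT F.property
  refine ⟨X, hX, ObjectProperty.homMk φ, ?_⟩
  have : ∀ Y, Epi (φ.app Y) := fun Y => (ModuleCat.epi_iff_surjective _).2 (hφ Y.unop)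
  have : Epi φ := NatTrans.epi_of_epi_app φ
  exact (ObjectProperty.ι _).epi_of_epi_map this

/-- By Yoneda, lifting means lifting one element. This is possible because `mod T` is closed under
cokernels of functors, so its epimorphisms are pointwise surjective. -/
lemma HFunctor_projective {X : C} (hX : T X) : Projective ((HFunctor k hT).obj X) := by
  let _ := fpModAbelian k hT
  refine ⟨fun {E F} f e he => ?_⟩
  have := finPres_containsZero k hT
  have := finPres_isClosedUnderCokernels k hT
  have := ObjectProperty.preservesEpimorphisms_ι_of_isNormalMonoCategory
    (fun F => IsFinPresModule k T.FullSubcategory F)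
  have h1 : Epi e.hom := inferInstanceAs (Epi ((ObjectProperty.ι _).map e))
  have h2 : Function.Surjective (e.hom.app (Opposite.op ⟨X, hX⟩)).hom :=
    (ModuleCat.epi_iff_surjective _).1 inferInstance
  obtain ⟨m, hm⟩ := h2 (evalAt f.hom ⟨X, hX⟩ (𝟙 X))
  obtain ⟨φ, hφ⟩ := exists_evalAt_eq E.property ⟨X, hX⟩ m
  refine ⟨ObjectProperty.homMk φ, ObjectProperty.hom_ext _ (evalAt_ext fun Y x => ?_)⟩
  change evalAt (φ ≫ e.hom) Y x = evalAt (M := X) f.hom Y x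
  have h3 : evalAt (M := X) (φ ≫ e.hom) ⟨X, hX⟩ (𝟙 X) = evalAt f.hom ⟨X, hX⟩ (𝟙 X) := by
    rw [evalAt_comp_hom, hφ, hm]
  have h4 := evalAt_comp (M := X) (φ ≫ e.hom) (X := ⟨X, hX⟩) (Y := Y) x (𝟙 X)
  have h5 := evalAt_comp (M := X) f.hom (X := ⟨X, hX⟩) (Y := Y) x (𝟙 X)
  rw [h3, ← h5, Category.comp_id] at h4
  exact h4

lemma HFunctor_epi_of_lift {M N : C} (g : M ⟶ N)
    (h : ∀ X, T X → ∀ x : X ⟶ N, ∃ y, y ≫ g = x) : Epi ((HFunctor k hT).map g) := by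
  have := HFunctor_full k hT
  obtain ⟨X, hX, φ, hφ⟩ := HFunctor_exists_cover k hT ((HFunctor k hT).obj N)
  obtain ⟨p, rfl⟩ := (HFunctor k hT).map_surjective φ
  obtain ⟨y, rfl⟩ := h X hX p
  rw [Functor.map_comp] at hφ
  exact epi_of_epi ((HFunctor k hT).map y) _

lemma HFunctor_mono_iff {M N : C} (f : M ⟶ N) :
    Mono ((HFunctor k hT).map f) ↔ ∀ X, T X → ∀ x : X ⟶ M, x ≫ f = 0 → x = 0 := by
  have := HFunctor_full k hT
  have := HFunctor_additive k hT
  constructor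
  · intro h X hX x hx
    apply HFunctor_map_injective k hT hX
    rw [Functor.map_zero, ← cancel_mono ((HFunctor k hT).map f), ← Functor.map_comp, hx,
      Functor.map_zero, zero_comp]
  · intro h
    refine Preadditive.mono_of_cancel_zero _ fun {G} g hg => ?_
    obtain ⟨X, hX, φ, hφ⟩ := HFunctor_exists_cover k hT G
    obtain ⟨x, hx⟩ := (HFunctor k hT).map_surjective (φ ≫ g)
    have hxf : x ≫ f = 0 := by
      apply HFunctor_map_injective k hT hX
      rw [Functor.map_comp, hx, Category.assoc, hg, comp_zero, Functor.map_zero]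
    rw [← cancel_epi φ, ← hx, h X hX x hxf, Functor.map_zero, comp_zero]

lemma HFunctor_comp_eq_zero {X Y Z : C} {f : X ⟶ Y} {g : Y ⟶ Z} (h : f ≫ g = 0) :
    (HFunctor k hT).map f ≫ (HFunctor k hT).map g = 0 := by
  have := HFunctor_additive k hT
  rw [← Functor.map_comp, h, Functor.map_zero]

lemma HFunctor_exact {X Y Z : C} {f : X ⟶ Y} {g : Y ⟶ Z} {h : Z ⟶ X⟦(1 : ℤ)⟧}
    (hD : Triangle.mk f g h ∈ distTriang C) :
    (ShortComplex.mk _ _ (HFunctor_comp_eq_zero k hT (dist_comp₁₂ hD))).Exact := by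
  let _ := fpModAbelian k hT
  have := HFunctor_full k hT
  have := HFunctor_additive k hT
  rw [ShortComplex.exact_iff_exact_up_to_refinements]
  intro A x hx
  obtain ⟨W, hW, φ, hφ⟩ := HFunctor_exists_cover k hT A
  obtain ⟨y, hy⟩ := (HFunctor k hT).map_surjective (φ ≫ x)
  have hyg : y ≫ g = 0 := by
    apply HFunctor_map_injective k hT hW
    rw [Functor.map_comp, hy, Category.assoc, Functor.map_zero]
    exact (congrArg (φ ≫ ·) hx).trans comp_zero
  obtain ⟨z, rfl⟩ := dist_lift₂ hD y hyg
  exact ⟨_, φ, hφ, (HFunctor k hT).map z, by rw [← hy, Functor.map_comp]⟩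

/-- A triangle gives a short exact sequence as soon as its outer maps behave well on `T`. -/
lemma HFunctor_shortExact {X Y Z : C} {f : X ⟶ Y} {g : Y ⟶ Z} {h : Z ⟶ X⟦(1 : ℤ)⟧}
    (hD : Triangle.mk f g h ∈ distTriang C)
    (hf : ∀ W, T W → ∀ x : W ⟶ X, x ≫ f = 0 → x = 0)
    (hh : ∀ W, T W → ∀ x : W ⟶ Z, x ≫ h = 0) :
    (ShortComplex.mk _ _ (HFunctor_comp_eq_zero k hT (dist_comp₁₂ hD))).ShortExact where
  exact := HFunctor_exact k hT hD
  mono_f := (HFunctor_mono_iff k hT f).2 hf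
  epi_g := HFunctor_epi_of_lift k hT g fun W hW x => dist_lift₃ hD x (hh W hW x)

/-- The projective finitely presented modules are those represented by objects of `T`. -/
lemma exists_iso_of_projective (hKS : IsKrullSchmidt C) (P : FPMod k T.FullSubcategory)
    [Projective P] : ∃ X, T X ∧ Nonempty ((HFunctor k hT).obj X ≅ P) := by
  have := HFunctor_full k hT
  have := hT.isSubcat.summands
  obtain ⟨X, hX, φ, hφ⟩ := HFunctor_exists_cover k hT P
  have hs : Projective.factorThru (𝟙 P) φ ≫ φ = 𝟙 P := Projective.factorThru_comp _ _
  generalize Projective.factorThru (𝟙 P) φ = s at hs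
  -- The idempotent of `ℍ X` cutting out `P` lifts to an idempotent of `X`, by fullness and by
  -- faithfulness out of `T`; its image lies in `T`.
  obtain ⟨e, he⟩ := (HFunctor k hT).map_surjective (φ ≫ s)
  have hee : e ≫ e = e := by
    apply HFunctor_map_injective k hT hX
    rw [Functor.map_comp, he, Category.assoc, reassoc_of% hs]
  obtain ⟨Z, i, p, hip, hpi⟩ := hKS.splitsIdem e hee
  have hZ : T Z := T.prop_of_retract ⟨i, p, hip⟩ hX
  refine ⟨Z, hZ, ⟨⟨(HFunctor k hT).map i ≫ φ, s ≫ (HFunctor k hT).map p, ?_, ?_⟩⟩⟩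
  · rw [Category.assoc, ← Category.assoc φ, ← he, ← Functor.map_comp, ← Functor.map_comp, ← hpi,
      Category.assoc, hip, Category.comp_id, hip, CategoryTheory.Functor.map_id]
  · rw [Category.assoc, ← Category.assoc ((HFunctor k hT).map p), ← Functor.map_comp, hpi, he,
      Category.assoc, reassoc_of% hs, hs]

end H

/-! ### Ghost cluster tilting subcategories of triangulated categories -/

section Ghost

variable {C : Type u} [Category.{v} C] [Preadditive C] [HasShift C ℤ] {T X : ObjectProperty C}

lemma idealVanishes_shift_iff {M N : C} :
    IdealVanishes (sh T 1) M N ↔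
      ∀ Y, T Y → ∀ (f : M ⟶ Y⟦(1 : ℤ)⟧) (g : Y⟦(1 : ℤ)⟧ ⟶ N), f ≫ g = 0 := by
  constructor
  · exact fun h Y hY f g => h _ (T.prop_map_obj _ hY) f g
  · rintro h Z ⟨Y, hY, ⟨e⟩⟩ f g
    simpa using h Y hY (f ≫ e.inv) (e.hom ≫ g)

/-- Every morphism between objects of `T[1]` that factors through `M` is zero. -/
def FactorizationVanishesAt (T : ObjectProperty C) (M : C) : Prop :=
  ∀ Y Y', T Y → T Y' → ∀ (f : Y⟦(1 : ℤ)⟧ ⟶ M) (g : M ⟶ Y'⟦(1 : ℤ)⟧), f ≫ g = 0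

lemma factorizationIdealVanishes_iff :
    FactorizationIdealVanishes T X ↔ ∀ M, X M → FactorizationVanishesAt T M := by
  constructor
  · exact fun h M hM Y Y' hY hY' f g =>
      h M hM _ _ (T.prop_map_obj _ hY) (T.prop_map_obj _ hY') f g
  · rintro h M hM Z Z' ⟨Y, hY, ⟨e⟩⟩ ⟨Y', hY', ⟨e'⟩⟩ f g
    have := h M hM Y Y' hY hY' (e.hom ≫ f) (g ≫ e'.inv)
    rw [← cancel_epi e.hom, ← cancel_mono e'.inv]
    simpa using this

lemma FactorizationVanishesAt.of_retract {M N : C} (r : Retract M N)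
    (h : FactorizationVanishesAt T N) : FactorizationVanishesAt T M := by
  intro Y Y' hY hY' f g
  simpa using h Y Y' hY hY' (f ≫ r.i) (r.r ≫ g)

lemma IsClusterTilting.hom_shift_eq_zero (hT : IsClusterTilting T) {A B : C} (hA : T A) (hB : T B)
    (f : A ⟶ B⟦(1 : ℤ)⟧) : f = 0 :=
  (hT.mem_iff_right B).1 hB A hA f

lemma IsClusterTilting.factorizationVanishesAt (hT : IsClusterTilting T) {A : C} (hA : T A) :
    FactorizationVanishesAt T A := by
  intro Y Y' _ hY' f g
  rw [hT.hom_shift_eq_zero hA hY' g, comp_zero]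

variable [HasZeroObject C] [∀ n : ℤ, (shiftFunctor C n).Additive] [Pretriangulated C]

/-- In a triangle starting in `T`, the first morphism is a monomorphism on `T` if the factorization
ideal of the third object vanishes. -/
lemma FactorizationVanishesAt.injective {A B M : C} {i : A ⟶ B} {p : B ⟶ M}
    {q : M ⟶ A⟦(1 : ℤ)⟧} (hD : Triangle.mk i p q ∈ distTriang C) (hA : T A)
    (hM : FactorizationVanishesAt T M) (W : C) (hW : T W) (x : W ⟶ A) (hx : x ≫ i = 0) :
    x = 0 := by
  obtain ⟨y, hy⟩ := dist_lift₁ hD (x⟦(1 : ℤ)⟧') (by rw [← Functor.map_comp, hx, Functor.map_zero])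
  rw [hM W A hW hA y q] at hy
  exact (shiftFunctor C (1 : ℤ)).map_injective (by rw [← hy, Functor.map_zero])

/-- For `f : Y⟦1⟧ ⟶ M`, the composite `f ≫ q` is the shift of a map killed by `i`, hence zero. So
`f` factors through `B`, whose ideal vanishes. -/
lemma FactorizationVanishesAt.of_injective {A B M : C} {i : A ⟶ B} {p : B ⟶ M}
    {q : M ⟶ A⟦(1 : ℤ)⟧} (hD : Triangle.mk i p q ∈ distTriang C)
    (hB : FactorizationVanishesAt T B)
    (hi : ∀ W, T W → ∀ x : W ⟶ A, x ≫ i = 0 → x = 0) : FactorizationVanishesAt T M := by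
  intro Y Y' hY hY' f g
  obtain ⟨x, hx⟩ := (shiftFunctor C (1 : ℤ)).map_surjective (f ≫ q)
  have hxi : x ≫ i = 0 := (shiftFunctor C (1 : ℤ)).map_injective (by
    rw [Functor.map_comp, hx, Category.assoc, dist_comp₃₁ hD, comp_zero, Functor.map_zero])
  rw [hi Y hY x hxi, Functor.map_zero] at hx
  obtain ⟨f', rfl⟩ := dist_lift₃ hD f hx.symm
  rw [Category.assoc, hB Y Y' hY hY']

/-- The vanishing of `[T[1]](M, N[1])` in terms of a two-term resolution of `M`. -/
lemma IsClusterTilting.idealVanishes_iff (hT : IsClusterTilting T) {T₁ T₀ M : C} {i : T₁ ⟶ T₀}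
    {p : T₀ ⟶ M} {q : M ⟶ T₁⟦(1 : ℤ)⟧} (hD : Triangle.mk i p q ∈ distTriang C) (h₁ : T T₁)
    (h₀ : T T₀) (N : C) :
    IdealVanishes (sh T 1) M (N⟦(1 : ℤ)⟧) ↔ ∀ a : T₁ ⟶ N, ∃ b : T₀ ⟶ N, i ≫ b = a := by
  rw [idealVanishes_shift_iff]
  constructor
  · intro h a
    have hD' : Triangle.mk p q (-i⟦(1 : ℤ)⟧') ∈ distTriang C := rot_of_distTriang _ hD
    obtain ⟨b, hb⟩ := dist_desc₃ hD' (a⟦(1 : ℤ)⟧') (h _ h₁ _ _)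
    obtain ⟨b, rfl⟩ := (shiftFunctor C (1 : ℤ)).map_surjective b
    -- The rotated triangle contains `-i⟦1⟧'`, whence the sign.
    refine ⟨-b, (shiftFunctor C (1 : ℤ)).map_injective ?_⟩
    rw [← hb]
    simp
  · intro h Y hY f g
    obtain ⟨v, rfl⟩ := dist_desc₃ hD f (hT.hom_shift_eq_zero h₀ hY _)
    obtain ⟨a, ha⟩ := (shiftFunctor C (1 : ℤ)).map_surjective (v ≫ g)
    obtain ⟨b, rfl⟩ := h a
    rw [Category.assoc, ← ha, Functor.map_comp, ← Category.assoc, dist_comp₃₁ hD, zero_comp]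

/-- Rotation puts the extension condition into the form of a coresolution, the triangulated
counterpart of (T3). -/
lemma le_extensionProduct_iff (hX : IsSubcat X) :
    T ≤ ObjectProperty.extensionProduct (sh X (-1)) X ↔
      ∀ Y, T Y → ∃ (X₀ X₁ : C) (a : Y ⟶ X₀) (b : X₀ ⟶ X₁) (c : X₁ ⟶ Y⟦(1 : ℤ)⟧), X X₀ ∧ X X₁ ∧
        Triangle.mk a b c ∈ distTriang C := by
  have := hX.summands
  constructor
  · intro h Y hY
    obtain ⟨Z, X₀, f, g, t, hD, ⟨X₁, hX₁, ⟨e⟩⟩, hX₀⟩ := h Y hY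
    refine ⟨X₀, Z⟦(1 : ℤ)⟧, g, t, _, hX₀, ?_, rot_of_distTriang _ hD⟩
    exact X.prop_of_iso (((shiftEquiv C (1 : ℤ)).counitIso.app X₁).symm ≪≫
      (shiftFunctor C (1 : ℤ)).mapIso e) hX₁
  · intro h Y hY
    obtain ⟨X₀, X₁, a, b, c, h₀, h₁, hD⟩ := h Y hY
    exact ⟨_, _, _, _, _, inv_rot_of_distTriang _ hD, X.prop_map_obj _ h₁, h₀⟩

/-- A subcategory `X` with `T ⊆ X[-1] ∗ X` and `[T[1]](X, X[1]) = 0` is weak `T[1]`-cluster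
tilting. -/
lemma isWeakGhostClusterTilting_of_rigid (hT : IsClusterTilting T) (hX : IsSubcat X)
    (hext : T ≤ ObjectProperty.extensionProduct (sh X (-1)) X)
    (hrigid : ∀ M N, X M → X N → IdealVanishes (sh T 1) M (N⟦(1 : ℤ)⟧)) :
    IsWeakGhostClusterTilting T X := by
  refine ⟨hX, hext, fun M => ⟨fun hM => ⟨fun Y hY => hrigid _ _ hM hY,
    fun Y hY => hrigid _ _ hY hM⟩, ?_⟩⟩
  rintro ⟨hM, hM'⟩
  have := hX.finiteSums
  have := hX.summands
  rw [le_extensionProduct_iff hX] at hext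
  obtain ⟨T₁, T₀, i, p, q, h₁, h₀, hD⟩ := hT.exists_triangle M
  obtain ⟨X₁, X₁', a, b, c, hX₁, hX₁', hD₁⟩ := hext T₁ h₁
  obtain ⟨X₀, X₀', a₀, b₀, c₀, hX₀, hX₀', hD₀⟩ := hext T₀ h₀
  -- the map `p` extends to `X₀`, and `q` lifts to `X₁'`
  have hD₀' : Triangle.mk b₀ c₀ (-a₀⟦(1 : ℤ)⟧') ∈ distTriang C := rot_of_distTriang _ hD₀
  obtain ⟨r₀, hr₀⟩ : ∃ r₀ : X₀ ⟶ M, a₀ ≫ r₀ = p := by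
    obtain ⟨b, hb⟩ := dist_desc₃ hD₀' (p⟦(1 : ℤ)⟧')
      (idealVanishes_shift_iff.1 (hM' X₀' hX₀') T₀ h₀ _ _)
    obtain ⟨b, rfl⟩ := (shiftFunctor C (1 : ℤ)).map_surjective b
    refine ⟨-b, (shiftFunctor C (1 : ℤ)).map_injective ?_⟩
    rw [← hb]
    simp
  obtain ⟨m, hm⟩ := dist_lift₁ hD₁ q (idealVanishes_shift_iff.1 (hM X₁ hX₁) T₁ h₁ _ _)
  -- The obstruction to lifting `c ≫ i⟦1⟧'` through `c₀` is a map `X₁' ⟶ X₀⟦1⟧` factoring through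
  -- `T₁⟦1⟧`, zero by rigidity.
  obtain ⟨n, hn⟩ := dist_lift₁ hD₀ (c ≫ i⟦(1 : ℤ)⟧') (by
    rw [Category.assoc, ← Functor.map_comp]
    exact idealVanishes_shift_iff.1 (hrigid X₁' X₀ hX₁' hX₀) T₁ h₁ _ _)
  obtain ⟨u, hu⟩ := dist_lift₃ hD₀ (m ≫ n) (by
    rw [Category.assoc, hn, reassoc_of% hm, dist_comp₃₁ hD])
  have hD' : Triangle.mk p q (-i⟦(1 : ℤ)⟧') ∈ distTriang C := rot_of_distTriang _ hD
  obtain ⟨r', hr₁, hr₂⟩ : ∃ r' : X₀' ⟶ T₁⟦(1 : ℤ)⟧,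
      b₀ ≫ r' = r₀ ≫ q ∧ c₀ ≫ (𝟙 T₀)⟦(1 : ℤ)⟧' = r' ≫ (-i⟦(1 : ℤ)⟧') :=
    complete_distinguished_triangle_morphism _ _ hD₀ hD' (𝟙 T₀) r₀
      (hr₀.trans (Category.id_comp p).symm)
  rw [CategoryTheory.Functor.map_id, Category.comp_id, Preadditive.comp_neg] at hr₂
  -- The term `n ≫ r'` makes `c` liftable through `q`. Then `m ≫ s - u ≫ r₀ - 𝟙 M` is killed by `q`,
  -- so it equals some `t ≫ p = t ≫ a₀ ≫ r₀`; thus `𝟙 M` factors through `X₁' ⊞ X₀`.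
  obtain ⟨s, hs⟩ := dist_lift₁ hD (c + n ≫ r') (by
    rw [Preadditive.add_comp, ← hn, hr₂, Category.assoc, Preadditive.comp_neg, neg_add_cancel])
  obtain ⟨t, ht⟩ := dist_lift₃ hD (m ≫ s - u ≫ r₀ - 𝟙 M) (by
    simp only [Preadditive.sub_comp, Category.assoc, hs, Preadditive.comp_add, hm, ← hr₁,
      reassoc_of% hu, Category.id_comp]
    abel)
  have hsum : X (X₁' ⊞ X₀) :=
    X.prop_of_isLimit_binaryFan (BinaryBiproduct.isLimit X₁' X₀) hX₁' hX₀
  refine X.prop_of_retract ⟨biprod.lift m (-(u + t ≫ a₀)), biprod.desc s r₀, ?_⟩ hsum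
  rw [biprod.lift_desc, Preadditive.neg_comp, Preadditive.add_comp, Category.assoc, hr₀, ht]
  abel

/-- `T[1]`-cluster tilting subcategories are weak `T[1]`-cluster tilting. -/
lemma IsGhostClusterTilting.isWeak (hT : IsClusterTilting T) (hX : IsGhostClusterTilting T X) :
    IsWeakGhostClusterTilting T X := by
  refine ⟨hX.isSubcat, (le_extensionProduct_iff hX.isSubcat).2 fun Y hY => ?_, hX.perp⟩
  obtain ⟨X₁, c, hX₁, hc⟩ := hX.contravariantlyFinite (Y⟦(1 : ℤ)⟧)
  obtain ⟨X₀, a, b, hD⟩ := distinguished_cocone_triangle₂ c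
  -- Maps from `X₀` to `Z⟦1⟧` with `Z` in `T` factor through `b`, so the first condition comes from
  -- `X₁`. A composite `N ⟶ Z⟦1⟧ ⟶ X₀⟦1⟧` dies in `X₁⟦1⟧`, so it lifts to `Y⟦1⟧`, hence through the
  -- approximation `c`, and `c ≫ a⟦1⟧' = 0`.
  refine ⟨X₀, X₁, a, b, c, (hX.perp X₀).2 ⟨fun N hN => ?_, fun N hN => ?_⟩, hX₁, hD⟩
  · rw [idealVanishes_shift_iff]
    intro Z hZ f g
    obtain ⟨f', rfl⟩ := dist_desc₂ hD f (hT.hom_shift_eq_zero hY hZ _)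
    rw [Category.assoc, idealVanishes_shift_iff.1 (((hX.perp X₁).1 hX₁).1 N hN) Z hZ, comp_zero]
  · rw [idealVanishes_shift_iff]
    intro Z hZ f g
    have h₁ : (f ≫ g) ≫ b⟦(1 : ℤ)⟧' = 0 := by
      rw [Category.assoc]
      exact idealVanishes_shift_iff.1 (((hX.perp X₁).1 hX₁).2 N hN) Z hZ _ _
    have hD' : Triangle.mk b c (-a⟦(1 : ℤ)⟧') ∈ distTriang C := rot_of_distTriang _ hD
    obtain ⟨v, hv⟩ := dist_lift₁ hD' (f ≫ g) h₁
    obtain ⟨w, rfl⟩ := hc N hN v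
    rw [← hv, Category.assoc, Preadditive.comp_neg, dist_comp₃₁ hD, neg_zero, comp_zero]

lemma IsWeakGhostClusterTilting.isGhost (hX : IsWeakGhostClusterTilting T X)
    (h : ContravariantlyFinite X) : IsGhostClusterTilting T X :=
  ⟨hX.isSubcat, h, hX.perp⟩

lemma IsClusterTilting.exists_coresolution (hX : IsClusterTilting X) (Y : C) :
    ∃ (X₀ X₁ : C) (a : Y ⟶ X₀) (b : X₀ ⟶ X₁) (c : X₁ ⟶ Y⟦(1 : ℤ)⟧), X X₀ ∧ X X₁ ∧
      Triangle.mk a b c ∈ distTriang C := by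
  obtain ⟨X₀, a, hX₀, ha⟩ := hX.covariantlyFinite Y
  obtain ⟨X₁, b, c, hD⟩ := distinguished_cocone_triangle a
  refine ⟨X₀, X₁, a, b, c, hX₀, (hX.mem_iff_left X₁).2 fun Z hZ f => ?_, hD⟩
  obtain ⟨v, rfl⟩ := dist_desc₃ hD f (hX.hom_shift_eq_zero hX₀ hZ _)
  obtain ⟨v, rfl⟩ := (shiftFunctor C (1 : ℤ)).map_surjective v
  obtain ⟨y, rfl⟩ := ha Z hZ v
  rw [Functor.map_comp, ← Category.assoc, dist_comp₃₁ hD, zero_comp]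

/-- Cluster tilting subcategories are `T[1]`-cluster tilting. -/
lemma IsClusterTilting.isGhost (hT : IsClusterTilting T) (hX : IsClusterTilting X) :
    IsGhostClusterTilting T X := by
  refine (isWeakGhostClusterTilting_of_rigid hT hX.isSubcat
    ((le_extensionProduct_iff hX.isSubcat).2 fun Y _ => hX.exists_coresolution Y)
    fun M N hM hN => ?_).isGhost hX.contravariantlyFinite
  rw [idealVanishes_shift_iff]
  exact fun _ _ _ _ => hX.hom_shift_eq_zero hM hN _

/-- A contravariantly finite subcategory equal to its right and left perpendicular subcategories is
cluster tilting. -/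
lemma isClusterTilting_of_contravariantlyFinite (hX : IsSubcat X) (hc : ContravariantlyFinite X)
    (hr : ∀ M : C, X M ↔ ∀ Y : C, X Y → ∀ f : Y ⟶ M⟦(1 : ℤ)⟧, f = 0)
    (hl : ∀ M : C, X M ↔ ∀ Y : C, X Y → ∀ f : M ⟶ Y⟦(1 : ℤ)⟧, f = 0) :
    IsClusterTilting X := by
  refine ⟨hX, fun A => ?_, hc, hr, hl⟩
  -- The fibre of a right approximation of `A⟦1⟧` provides a left approximation of `A`.
  obtain ⟨X', c, hX', hc⟩ := hc (A⟦(1 : ℤ)⟧)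
  obtain ⟨K, a, b, hD⟩ := distinguished_cocone_triangle₂ c
  refine ⟨K, a, (hr K).2 fun Y hY f => ?_, fun Y hY f => ?_⟩
  · have hD' : Triangle.mk b c (-a⟦(1 : ℤ)⟧') ∈ distTriang C := rot_of_distTriang _ hD
    obtain ⟨v, rfl⟩ := dist_lift₁ hD' f ((hr X').1 hX' Y hY _)
    obtain ⟨w, rfl⟩ := hc Y hY v
    rw [Category.assoc, Preadditive.comp_neg, dist_comp₃₁ hD, neg_zero, comp_zero]
  · have hD' : Triangle.mk b c (-a⟦(1 : ℤ)⟧') ∈ distTriang C := rot_of_distTriang _ hD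
    obtain ⟨v, hv⟩ := dist_desc₃ hD' (f⟦(1 : ℤ)⟧') ((hl X').1 hX' Y hY _)
    obtain ⟨v, rfl⟩ := (shiftFunctor C (1 : ℤ)).map_surjective v
    refine ⟨-v, (shiftFunctor C (1 : ℤ)).map_injective ?_⟩
    rw [← hv]
    simp

end Ghost

/-! ### Serre functors and `F`-stability -/

section Serre

variable {k : Type w} [Field k] {C : Type u} [Category.{v} C] [Preadditive C] [Linear k C]
  [HasShift C ℤ] {T X : ObjectProperty C}

/-- The defining property of `F`, up to applying the Serre functor. -/
lemma SerreFunctor.nonempty_iso_iff (S : SerreFunctor k C) (M N : C) :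
    Nonempty (S.F.obj N ≅ M) ↔ Nonempty (S.S.functor.obj M ≅ N⟦(1 : ℤ)⟧⟦(1 : ℤ)⟧) := by
  have e : S.F.obj N ≅ S.S.inverse.obj (N⟦(1 : ℤ)⟧⟦(1 : ℤ)⟧) := Iso.refl _
  constructor
  · rintro ⟨f⟩
    exact ⟨S.S.functor.mapIso (f.symm ≪≫ e) ≪≫ S.S.counitIso.app _⟩
  · rintro ⟨f⟩
    exact ⟨e ≪≫ S.S.inverse.mapIso f.symm ≪≫ (S.S.unitIso.app M).symm⟩

/-- Serre duality exchanges `Hom(M, Y[1])` and `Hom(Y, N[1])` when `S M = N[2]`. -/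
lemma SerreFunctor.hom_eq_zero_iff [∀ n : ℤ, (shiftFunctor C n).Additive] (S : SerreFunctor k C)
    {M N : C} (e : S.S.functor.obj M ≅ N⟦(1 : ℤ)⟧⟦(1 : ℤ)⟧) (Y : C) :
    (∀ f : M ⟶ Y⟦(1 : ℤ)⟧, f = 0) ↔ ∀ g : Y ⟶ N⟦(1 : ℤ)⟧, g = 0 := by
  constructor
  · intro h g
    by_contra hg
    have hg' : g⟦(1 : ℤ)⟧' ≫ e.inv ≠ 0 := by
      intro h0
      apply hg
      apply (shiftFunctor C (1 : ℤ)).map_injective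
      rw [← cancel_mono e.inv, h0, Functor.map_zero, zero_comp]
    obtain ⟨l, hl⟩ : ∃ l : Module.Dual k (Y⟦(1 : ℤ)⟧ ⟶ S.S.functor.obj M),
        l (g⟦(1 : ℤ)⟧' ≫ e.inv) ≠ 0 := by
      by_contra! hcon
      exact hg' ((Module.forall_dual_apply_eq_zero_iff k _).1 hcon)
    apply hl
    have := h ((S.duality M (Y⟦(1 : ℤ)⟧)).symm l)
    rw [LinearEquiv.map_eq_zero_iff] at this
    rw [this, LinearMap.zero_apply]
  · intro h f
    have : S.duality M (Y⟦(1 : ℤ)⟧) f = 0 := by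
      ext g
      obtain ⟨g', hg'⟩ := (shiftFunctor C (1 : ℤ)).map_surjective (g ≫ e.hom)
      rw [h g', Functor.map_zero] at hg'
      have : g = 0 := by rw [← cancel_mono e.hom, ← hg', zero_comp]
      rw [this, map_zero, map_zero]
    exact (LinearEquiv.map_eq_zero_iff _).1 this

lemma SerreFunctor.fStable_iff (S : SerreFunctor k C) [X.IsClosedUnderIsomorphisms] :
    S.FStable X ↔
      (∀ M, X M → ∃ N, X N ∧ Nonempty (S.S.functor.obj M ≅ N⟦(1 : ℤ)⟧⟦(1 : ℤ)⟧)) ∧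
      (∀ N, X N → ∃ M, X M ∧ Nonempty (S.S.functor.obj M ≅ N⟦(1 : ℤ)⟧⟦(1 : ℤ)⟧)) := by
  simp only [← S.nonempty_iso_iff]
  constructor
  · intro h
    refine ⟨fun M hM => ?_, fun N hN => ⟨S.F.obj N, ?_, ⟨Iso.refl _⟩⟩⟩
    · rw [← show X.map S.F = X from h] at hM
      exact hM
    · rw [← show X.map S.F = X from h]
      exact X.prop_map_obj _ hN
  · rintro ⟨h₁, h₂⟩
    refine le_antisymm ?_ h₁
    rintro M ⟨N, hN, ⟨e⟩⟩
    obtain ⟨M', hM', ⟨e'⟩⟩ := h₂ N hN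
    exact X.prop_of_iso (e'.symm ≪≫ e) hM'

variable [∀ n : ℤ, (shiftFunctor C n).Additive]

/-- A cluster tilting subcategory is `F`-stable. -/
lemma IsClusterTilting.fStable (S : SerreFunctor k C) (hX : IsClusterTilting X) : S.FStable X := by
  have := hX.isSubcat.summands
  rw [S.fStable_iff]
  have key : ∀ {M N : C}, (S.S.functor.obj M ≅ N⟦(1 : ℤ)⟧⟦(1 : ℤ)⟧) → (X M ↔ X N) := by
    intro M N e
    rw [hX.mem_iff_left, hX.mem_iff_right]
    exact forall₂_congr fun Y _ => S.hom_eq_zero_iff e Y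
  constructor
  · intro M hM
    let N := (S.S.functor.obj M)⟦(-1 : ℤ)⟧⟦(-1 : ℤ)⟧
    let e : N⟦(1 : ℤ)⟧⟦(1 : ℤ)⟧ ≅ S.S.functor.obj M :=
      (shiftFunctor C (1 : ℤ)).mapIso ((shiftEquiv C (1 : ℤ)).counitIso.app _) ≪≫
        (shiftEquiv C (1 : ℤ)).counitIso.app _
    exact ⟨N, (key e.symm).1 hM, ⟨e.symm⟩⟩
  · intro N hN
    obtain ⟨e⟩ := (S.nonempty_iso_iff _ _).1 ⟨Iso.refl (S.F.obj N)⟩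
    exact ⟨_, (key e).2 hN, ⟨e⟩⟩

variable [HasZeroObject C] [Pretriangulated C]

/-- An `F`-stable `T[1]`-cluster tilting subcategory is cluster tilting. -/
lemma IsGhostClusterTilting.isClusterTilting (hT : IsClusterTilting T) (S : SerreFunctor k C)
    (hX : IsGhostClusterTilting T X) (hF : S.FStable X) : IsClusterTilting X := by
  have := hX.isSubcat.summands
  obtain ⟨hF₁, hF₂⟩ := S.fStable_iff.1 hF
  have hrigid : ∀ M N : C, X M → X N → ∀ f : M ⟶ N⟦(1 : ℤ)⟧, f = 0 := by
    intro M N hM hN f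
    obtain ⟨M', hM', ⟨e⟩⟩ := hF₁ M hM
    obtain ⟨T₁, T₀, i, p, q, h₁, h₀, hD⟩ := hT.exists_triangle N
    -- Serre duality pairs this map with maps `T₁⟦2⟧ ⟶ S M ≅ M'⟦2⟧`. Precomposed with `q⟦1⟧'`, these
    -- are shifts of elements of `[T[1]](N, M'[1]) = 0`. Hence `f` factors through `T₀⟦1⟧` and
    -- vanishes.
    have hf : f ≫ q⟦(1 : ℤ)⟧' = 0 := by
      apply (S.duality M _).injective
      rw [map_zero]
      ext g
      obtain ⟨g', hg'⟩ := (shiftFunctor C (1 : ℤ)).map_surjective (g ≫ e.hom)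
      have hqg : q⟦(1 : ℤ)⟧' ≫ g = 0 := by
        rw [← cancel_mono e.hom, Category.assoc, ← hg', ← Functor.map_comp,
          idealVanishes_shift_iff.1 (((hX.perp N).1 hN).1 M' hM') T₁ h₁, Functor.map_zero,
          zero_comp]
      rw [S.natural_right, hqg, map_zero, LinearMap.zero_apply]
    have hD' : Triangle.mk (-i⟦(1 : ℤ)⟧') (-p⟦(1 : ℤ)⟧') (-q⟦(1 : ℤ)⟧') ∈ distTriang C :=
      rot_of_distTriang _ (rot_of_distTriang _ (rot_of_distTriang _ hD))
    obtain ⟨g, rfl⟩ := dist_lift₃ hD' f (by rw [Preadditive.comp_neg, hf, neg_zero])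
    exact idealVanishes_shift_iff.1 (((hX.perp M).1 hM).1 N hN) T₀ h₀ _ _
  have hperp : ∀ M : C, (∀ Y, X Y → ∀ f : Y ⟶ M⟦(1 : ℤ)⟧, f = 0) →
      (∀ Y, X Y → ∀ f : M ⟶ Y⟦(1 : ℤ)⟧, f = 0) → X M := by
    intro M h h'
    refine (hX.perp M).2 ⟨fun Y hY => ?_, fun Y hY => ?_⟩
    · exact idealVanishes_shift_iff.2 fun _ _ _ _ => h' Y hY _
    · exact idealVanishes_shift_iff.2 fun _ _ _ _ => h Y hY _
  -- By `F`-stability and Serre duality, either one-sided orthogonality implies the other.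
  refine isClusterTilting_of_contravariantlyFinite hX.isSubcat hX.contravariantlyFinite
    (fun M => ⟨fun hM Y hY => hrigid Y M hY hM, fun h => hperp M h fun Y hY => ?_⟩)
    (fun M => ⟨fun hM Y hY => hrigid M Y hM hY, fun h => hperp M (fun Y hY => ?_) h⟩)
  · obtain ⟨Y', hY', ⟨e⟩⟩ := hF₂ Y hY
    exact (S.hom_eq_zero_iff e M).1 (h Y' hY')
  · obtain ⟨Y', hY', ⟨e⟩⟩ := hF₁ Y hY
    exact (S.hom_eq_zero_iff e M).2 (h Y' hY')

end Serre

/-! ### Weak tilting subcategories and ghost cluster tilting subcategories -/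

/-- Cokernels of morphisms with the same image are isomorphic. -/
lemma nonempty_iso_of_exact {A : Type u} [Category.{v} A] [Abelian A] {X Y Z X' Y' Z' : A}
    {f : X ⟶ Y} {g : Y ⟶ Z} {zero : f ≫ g = 0} {f' : X' ⟶ Y'} {g' : Y' ⟶ Z'}
    {zero' : f' ≫ g' = 0} (hS : (ShortComplex.mk f g zero).Exact)
    (hS' : (ShortComplex.mk f' g' zero').Exact) [Epi g] [Epi g'] (t : X ⟶ X') [Epi t] (e : Y ≅ Y')
    (comm : f ≫ e.hom = t ≫ f') : Nonempty (Z ≅ Z') := by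
  have : Epi (ShortComplex.mk f g zero).g := ‹Epi g›
  have : Epi (ShortComplex.mk f' g' zero').g := ‹Epi g'›
  obtain ⟨u, hu⟩ := hS.desc' (e.hom ≫ g') (by
    dsimp
    rw [reassoc_of% comm, zero', comp_zero])
  obtain ⟨v, hv⟩ := hS'.desc' (e.inv ≫ g) (by
    dsimp
    rw [← cancel_epi t, comp_zero, ← reassoc_of% comm, e.hom_inv_id_assoc, zero])
  dsimp at u v hu hv
  refine ⟨⟨u, v, ?_, ?_⟩⟩
  · rw [← cancel_epi g, reassoc_of% hu, hv, e.hom_inv_id_assoc, Category.comp_id]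
  · rw [← cancel_epi g', reassoc_of% hv, hu, e.inv_hom_id_assoc, Category.comp_id]

/-! ### Closure properties of vanishing factorization ideals -/

section Shift

variable {C : Type u} [Category.{v} C] [Preadditive C] [HasShift C ℤ] {T X : ObjectProperty C}

lemma FactorizationVanishesAt.isClosedUnderFiniteProducts [HasFiniteBiproducts C] :
    ObjectProperty.IsClosedUnderFiniteProducts (FactorizationVanishesAt T) where
  isClosedUnderLimitsOfShape J _ := ⟨by
    rintro M ⟨p⟩
    have := Fintype.ofFinite J
    let e : M ≅ ⨁ fun j => p.diag.obj ⟨j⟩ :=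
      p.isLimit.conePointsIsoOfNatIso (biproduct.isLimit fun j => p.diag.obj ⟨j⟩)
        (Discrete.natIso fun _ => Iso.refl _)
    refine FactorizationVanishesAt.of_retract e.retract fun Y Y' hY hY' f g => ?_
    rw [← Category.id_comp g, ← biproduct.total, Preadditive.sum_comp, Preadditive.comp_sum]
    refine Finset.sum_eq_zero fun j _ => ?_
    have := p.prop_diag_obj ⟨j⟩ Y Y' hY hY' (f ≫ biproduct.π _ j)
      (biproduct.ι (fun j => p.diag.obj ⟨j⟩) j ≫ g)
    simpa only [Category.assoc] using this⟩

/-- The identity of a summand in `T[1]` factors through the whole object. -/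
lemma FactorizationIdealVanishes.noSummandsInShift [HasZeroObject C]
    [∀ n : ℤ, (shiftFunctor C n).Additive] [Pretriangulated C]
    (h : FactorizationIdealVanishes T X) :
    NoSummandsInShift T X := by
  rintro M N L hM ⟨e⟩ hN
  rw [IsZero.iff_id_eq_zero]
  have := h M hM N N hN hN (biprod.inl ≫ e.inv) (e.hom ≫ biprod.fst)
  simpa using this

end Shift

/-! ### The correspondence between rigidity relative to `T[1]` and `Ext¹` -/

section H

variable (k : Type w) [Field k] {C : Type u} [Category.{v} C] [Preadditive C] [Linear k C]
  {T : ObjectProperty C} [HasZeroObject C] [HasShift C ℤ] [∀ n : ℤ, (shiftFunctor C n).Additive]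
  [Pretriangulated C] (hT : IsClusterTilting T)

include hT

/-- The vanishing of `[T[1]](M, N[1])` only depends on `ℍ N`, and passes to retracts of it. -/
lemma idealVanishes_of_retract {M N N' : C}
    (r : Retract ((HFunctor k hT).obj N) ((HFunctor k hT).obj N'))
    (h : IdealVanishes (sh T 1) M (N'⟦(1 : ℤ)⟧)) : IdealVanishes (sh T 1) M (N⟦(1 : ℤ)⟧) := by
  have := HFunctor_full k hT
  obtain ⟨T₁, T₀, i, p, q, h₁, h₀, hD⟩ := hT.exists_triangle M
  rw [hT.idealVanishes_iff hD h₁ h₀] at h ⊢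
  intro a
  obtain ⟨a', ha'⟩ := (HFunctor k hT).map_surjective ((HFunctor k hT).map a ≫ r.i)
  obtain ⟨b', hb'⟩ := h a'
  obtain ⟨b, hb⟩ := (HFunctor k hT).map_surjective ((HFunctor k hT).map b' ≫ r.r)
  refine ⟨b, HFunctor_map_injective k hT h₁ ?_⟩
  rw [Functor.map_comp, hb, ← Category.assoc, ← Functor.map_comp, hb', ha', Category.assoc,
    r.retract, Category.comp_id]

/-- A two-term resolution of an object with vanishing factorization ideal gives a projective
resolution of length one. -/
lemma FactorizationVanishesAt.shortExact {M T₁ T₀ : C} (hM : FactorizationVanishesAt T M)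
    {i : T₁ ⟶ T₀} {p : T₀ ⟶ M} {q : M ⟶ T₁⟦(1 : ℤ)⟧} (h₁ : T T₁)
    (hD : Triangle.mk i p q ∈ distTriang C) :
    (ShortComplex.mk _ _ (HFunctor_comp_eq_zero k hT (dist_comp₁₂ hD))).ShortExact :=
  HFunctor_shortExact k hT hD (hM.injective hD h₁) fun _ hW _ => hT.hom_shift_eq_zero hW h₁ _

lemma FactorizationVanishesAt.projDimLEOne {M : C} (hM : FactorizationVanishesAt T M) :
    ProjDimLEOne ((HFunctor k hT).obj M) := by
  obtain ⟨T₁, T₀, i, p, q, h₁, h₀, hD⟩ := hT.exists_triangle M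
  exact ⟨_, _, _, _, _, HFunctor_projective k hT h₁, HFunctor_projective k hT h₀,
    hM.shortExact k hT h₁ hD⟩

lemma FactorizationVanishesAt.extOneVanishes_iff {M : C} (hM : FactorizationVanishesAt T M)
    (N : C) : ExtOneVanishes ((HFunctor k hT).obj M) ((HFunctor k hT).obj N) ↔
      IdealVanishes (sh T 1) M (N⟦(1 : ℤ)⟧) := by
  let _ := fpModAbelian k hT
  have := HFunctor_full k hT
  obtain ⟨T₁, T₀, i, p, q, h₁, h₀, hD⟩ := hT.exists_triangle M
  rw [hT.idealVanishes_iff hD h₁ h₀, GhostTilting.extOneVanishes_iff (hM.shortExact k hT h₁ hD)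
    (HFunctor_projective k hT h₀)]
  constructor
  · intro h a
    obtain ⟨b, hb⟩ := h ((HFunctor k hT).map a)
    obtain ⟨b, rfl⟩ := (HFunctor k hT).map_surjective b
    exact ⟨b, HFunctor_map_injective k hT h₁ (by rw [Functor.map_comp, hb])⟩
  · intro h a
    obtain ⟨a, rfl⟩ := (HFunctor k hT).map_surjective a
    obtain ⟨b, rfl⟩ := h a
    exact ⟨(HFunctor k hT).map b, ((HFunctor k hT).map_comp _ _).symm⟩

/-- A module which is a retract of a module of projective dimension at most one comes from an
object with vanishing factorization ideal. -/
lemma exists_factorizationVanishesAt (hKS : IsKrullSchmidt C) {F G : FPMod k T.FullSubcategory}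
    (r : Retract F G) (hG : ProjDimLEOne G) :
    ∃ M, FactorizationVanishesAt T M ∧ Nonempty ((HFunctor k hT).obj M ≅ F) := by
  let _ := fpModAbelian k hT
  have := HFunctor_full k hT
  have := hG.hasProjectiveDimensionLT
  have := r.hasProjectiveDimensionLT 2
  obtain ⟨T₀, h₀, φ, hφ⟩ := HFunctor_exists_cover k hT F
  have := HFunctor_projective k hT h₀
  have := projective_kernel φ
  obtain ⟨T₁, h₁, ⟨e⟩⟩ := exists_iso_of_projective k hT hKS (kernel φ)
  -- A projective resolution of `F` is realised by a map `i` of `T`; the cone of `i` is the object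
  -- sought.
  obtain ⟨i, hi⟩ := (HFunctor k hT).map_surjective (e.hom ≫ kernel.ι φ)
  obtain ⟨M, p, q, hD⟩ := distinguished_cocone_triangle i
  have hM : FactorizationVanishesAt T M := .of_injective hD (hT.factorizationVanishesAt h₀)
    ((HFunctor_mono_iff k hT i).1 (by rw [hi]; infer_instance))
  refine ⟨M, hM, ?_⟩
  have hS := hM.shortExact k hT h₁ hD
  have : Epi ((HFunctor k hT).map p) := hS.epi_g
  exact nonempty_iso_of_exact hS.exact
    (ShortComplex.exact_of_f_is_kernel (ShortComplex.mk _ _ (kernel.condition φ))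
      (kernelIsKernel φ)) e.hom (Iso.refl _) (by simpa using hi)

omit hT in
/-- The objects with vanishing factorization ideal which `ℍ` sends to `Y`. -/
def HLift (Y : ObjectProperty (FPMod k T.FullSubcategory)) : ObjectProperty C :=
  fun M => Y ((HFunctor k hT).obj M) ∧ FactorizationVanishesAt T M

variable {k} {Y : ObjectProperty (FPMod k T.FullSubcategory)}

lemma HLift_factorizationIdealVanishes (Y : ObjectProperty (FPMod k T.FullSubcategory)) :
    FactorizationIdealVanishes T (HLift k hT Y) :=
  factorizationIdealVanishes_iff.2 fun _ hM => hM.2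

lemma IsWeakTilting.exists_HLift (hKS : IsKrullSchmidt C) (hY : IsWeakTilting Y)
    {F : FPMod k T.FullSubcategory} (hF : Y F) :
    ∃ M, HLift k hT Y M ∧ Nonempty ((HFunctor k hT).obj M ≅ F) := by
  have := hY.isSubcat.summands
  obtain ⟨M, hM, ⟨e⟩⟩ := exists_factorizationVanishesAt k hT hKS (Retract.refl F)
    (hY.projDim_le_one F hF)
  exact ⟨M, ⟨Y.prop_of_iso e.symm hF, hM⟩, ⟨e⟩⟩

lemma IsWeakTilting.HImage_HLift (hKS : IsKrullSchmidt C) (hY : IsWeakTilting Y) :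
    HImage k hT (HLift k hT Y) = Y := by
  have := hY.isSubcat.summands
  refine le_antisymm ?_ fun F hF => hY.exists_HLift hT hKS hF
  rintro F ⟨M, hM, ⟨e⟩⟩
  exact Y.prop_of_iso e hM.1

lemma IsWeakTilting.isSubcat_HLift (hY : IsWeakTilting Y) : IsSubcat (HLift k hT Y) := by
  have := hY.isSubcat.summands
  have := hY.isSubcat.finiteSums
  have := HFunctor_additive k hT
  refine ⟨⟨fun J _ => ⟨?_⟩⟩, ⟨fun r hM => ⟨Y.prop_of_retract (r.map _) hM.1, hM.2.of_retract r⟩⟩⟩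
  rintro M ⟨p⟩
  have := FactorizationVanishesAt.isClosedUnderFiniteProducts (T := T)
  exact ⟨Y.prop_of_isLimit (isLimitOfPreserves (HFunctor k hT) p.isLimit)
      fun j => (p.prop_diag_obj j).1,
    ObjectProperty.prop_of_isLimit (FactorizationVanishesAt T) p.isLimit
      fun j => (p.prop_diag_obj j).2⟩

/-- Rigidity is (T1). For coresolutions, the monomorphism of (T3) lifts to `a : P ⟶ X₀`; its cone
has the right image under `ℍ`, and a vanishing factorization ideal because `ℍ a` is mono. -/
lemma IsWeakTilting.isWeakGhostClusterTilting_HLift (hKS : IsKrullSchmidt C)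
    (hY : IsWeakTilting Y) : IsWeakGhostClusterTilting T (HLift k hT Y) := by
  let _ := fpModAbelian k hT
  have := HFunctor_full k hT
  have := hY.isSubcat.summands
  have hX := hY.isSubcat_HLift hT
  refine isWeakGhostClusterTilting_of_rigid hT hX
    ((le_extensionProduct_iff hX).2 fun P hP => ?_)
    fun M N hM hN => (hM.2.extOneVanishes_iff k hT N).1 (hY.ext_vanishes _ _ hM.1 hN.1)
  obtain ⟨M₀, M₁, i, p, zero, hM₀, hM₁, hS⟩ :=
    hY.coresolution _ (HFunctor_projective k hT hP)
  obtain ⟨X₀, hX₀, ⟨e⟩⟩ := hY.exists_HLift hT hKS hM₀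
  obtain ⟨a, ha⟩ := (HFunctor k hT).map_surjective (i ≫ e.inv)
  obtain ⟨X₁, b, c, hD⟩ := distinguished_cocone_triangle a
  have : Mono i := hS.mono_f
  have : Epi p := hS.epi_g
  have hmono : ∀ W, T W → ∀ x : W ⟶ P, x ≫ a = 0 → x = 0 :=
    (HFunctor_mono_iff k hT a).1 (by rw [ha]; infer_instance)
  have hS' := HFunctor_shortExact k hT hD hmono fun _ hW _ => hT.hom_shift_eq_zero hW hP _
  have : Epi ((HFunctor k hT).map b) := hS'.epi_g
  obtain ⟨e'⟩ := nonempty_iso_of_exact hS'.exact hS.exact (𝟙 _) e (by simp [ha])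
  exact ⟨X₀, X₁, a, b, c, hX₀, ⟨Y.prop_of_iso e'.symm hM₁, .of_injective hD hX₀.2 hmono⟩, hD⟩

/-- There is at most one weak `T[1]`-cluster tilting subcategory with a given weak tilting image. -/
lemma IsWeakTilting.eq_HLift (hKS : IsKrullSchmidt C) (hY : IsWeakTilting Y)
    {X : ObjectProperty C} (hX : IsWeakGhostClusterTilting T X) (h : HImage k hT X = Y) :
    X = HLift k hT Y := by
  have hL := hY.isWeakGhostClusterTilting_HLift hT hKS
  -- Second arguments can be exchanged between `X` and `HLift k hT Y`. Applied in both orders, this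
  -- yields both perpendicularity conditions without ever changing the first argument.
  have key : ∀ M N, X N → (∀ N', HLift k hT Y N' → IdealVanishes (sh T 1) M (N'⟦(1 : ℤ)⟧)) →
      IdealVanishes (sh T 1) M (N⟦(1 : ℤ)⟧) := by
    intro M N hN h'
    obtain ⟨N', hN', ⟨e⟩⟩ := hY.exists_HLift hT hKS (F := (HFunctor k hT).obj N)
      (by rw [← h]; exact X.prop_map_obj _ hN)
    exact idealVanishes_of_retract k hT e.symm.retract (h' N' hN')
  have key' : ∀ M N, HLift k hT Y N → (∀ N', X N' → IdealVanishes (sh T 1) M (N'⟦(1 : ℤ)⟧)) →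
      IdealVanishes (sh T 1) M (N⟦(1 : ℤ)⟧) := by
    intro M N hN h'
    have hN₁ := hN.1
    rw [← h] at hN₁
    obtain ⟨N', hN', ⟨e⟩⟩ := hN₁
    exact idealVanishes_of_retract k hT e.symm.retract (h' N' hN')
  have hle : X ≤ HLift k hT Y := fun M hM => (hL.perp M).2
    ⟨fun N hN => key' M N hN fun N' hN' => ((hX.perp M).1 hM).1 N' hN',
      fun N hN => key N M hM fun N' hN' => ((hL.perp N).1 hN).1 N' hN'⟩
  refine le_antisymm hle fun M hM => (hX.perp M).2 ⟨fun N hN => ?_, fun N hN => ?_⟩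
  · exact ((hL.perp M).1 hM).1 N (hle N hN)
  · exact ((hL.perp M).1 hM).2 N (hle N hN)

lemma IsWeakTilting.HPreimage_eq (hKS : IsKrullSchmidt C) (hY : IsWeakTilting Y) :
    HPreimage k hT Y = HLift k hT Y := by
  ext M
  constructor
  · rintro ⟨X, hX, h, hM⟩
    rwa [hY.eq_HLift hT hKS hX h] at hM
  · exact fun hM => ⟨_, hY.isWeakGhostClusterTilting_HLift hT hKS, hY.HImage_HLift hT hKS, hM⟩

variable (k) in
/-- The image of a weak `T[1]`-cluster tilting subcategory with vanishing factorization ideals is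
weak tilting. -/
lemma IsWeakGhostClusterTilting.isWeakTilting_HImage (hKS : IsKrullSchmidt C)
    {X : ObjectProperty C} (hX : IsWeakGhostClusterTilting T X)
    (hI : FactorizationIdealVanishes T X) : IsWeakTilting (HImage k hT X) := by
  let _ := fpModAbelian k hT
  have := HFunctor_full k hT
  have := HFunctor_additive k hT
  have := hX.isSubcat.finiteSums
  have := hX.isSubcat.summands
  rw [factorizationIdealVanishes_iff] at hI
  refine ⟨⟨isClosedUnderFiniteProducts_map (HFunctor k hT) X, ⟨?_⟩⟩, ?_, ?_, ?_⟩
  · rintro F G r ⟨M, hM, ⟨e⟩⟩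
    -- A summand of `ℍ M` need not be known to lift to a summand of `M`. It lifts to some `N` with
    -- vanishing ideal, and `N` lies in `X` by perpendicularity, tested through `Ext¹` in the first
    -- argument and through `ℍ N` in the second.
    obtain ⟨N, hN, ⟨e'⟩⟩ := exists_factorizationVanishesAt k hT hKS (r.trans e.symm.retract)
      ((hI M hM).projDimLEOne k hT)
    have r' : Retract ((HFunctor k hT).obj N) ((HFunctor k hT).obj M) :=
      e'.retract.trans (r.trans e.symm.retract)
    refine ⟨N, (hX.perp N).2 ⟨fun L hL => ?_, fun L hL => ?_⟩, ⟨e'⟩⟩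
    · rw [← hN.extOneVanishes_iff k hT]
      have hML := ((hI M hM).extOneVanishes_iff k hT L).2 (((hX.perp M).1 hM).1 L hL)
      exact hML.of_retract r' (Iso.refl _)
    · exact idealVanishes_of_retract k hT r' (((hX.perp M).1 hM).2 L hL)
  · rintro F G ⟨M, hM, ⟨e⟩⟩ ⟨N, hN, ⟨e'⟩⟩
    exact (((hI M hM).extOneVanishes_iff k hT N).2 (((hX.perp M).1 hM).1 N hN)).of_retract
      e.symm.retract e'
  · rintro F ⟨M, hM, ⟨e⟩⟩
    obtain ⟨P₁, P₀, i, p, zero, h₁, h₀, hS⟩ := (hI M hM).projDimLEOne k hT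
    refine ⟨P₁, P₀, i, p ≫ e.hom, by rw [reassoc_of% zero, zero_comp], h₁, h₀, ?_⟩
    exact ShortComplex.shortExact_of_iso (S₁ := .mk _ _ zero)
      (ShortComplex.isoMk (Iso.refl _) (Iso.refl _) e (by simp) (by simp)) hS
  · intro P hP
    obtain ⟨W, hW, ⟨e⟩⟩ := exists_iso_of_projective k hT hKS P
    obtain ⟨X₀, X₁, a, b, c, hX₀, hX₁, hD⟩ :=
      (le_extensionProduct_iff hX.isSubcat).1 hX.le_extension W hW
    have hS := HFunctor_shortExact k hT hD ((hI X₁ hX₁).injective hD hW)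
      fun _ hZ _ => hT.hom_shift_eq_zero hZ hW _
    refine ⟨_, _, e.inv ≫ (HFunctor k hT).map a, (HFunctor k hT).map b, ?_,
      X.prop_map_obj _ hX₀, X.prop_map_obj _ hX₁, ?_⟩
    · rw [Category.assoc, HFunctor_comp_eq_zero k hT (dist_comp₁₂ hD), comp_zero]
    · exact ShortComplex.shortExact_of_iso
        (S₁ := .mk _ _ (HFunctor_comp_eq_zero k hT (dist_comp₁₂ hD)))
        (ShortComplex.isoMk e (Iso.refl _) (Iso.refl _) (by simp) (by simp)) hS

variable (k) in
-- Density and fullness of `ℍ` carry right approximations over.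
lemma contravariantlyFinite_HImage {X : ObjectProperty C} (hX : ContravariantlyFinite X) :
    ContravariantlyFinite (HImage k hT X) := by
  have := HFunctor_full k hT
  intro F
  obtain ⟨M, ⟨e⟩⟩ := HFunctor_exists_iso k hT F
  obtain ⟨D, f, hD, hf⟩ := hX M
  refine ⟨(HFunctor k hT).obj D, (HFunctor k hT).map f ≫ e.hom, X.prop_map_obj _ hD, ?_⟩
  rintro G ⟨D', hD', ⟨e'⟩⟩ g
  obtain ⟨g', hg'⟩ := (HFunctor k hT).map_surjective (e'.hom ≫ g ≫ e.inv)
  obtain ⟨h, rfl⟩ := hf D' hD' g'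
  refine ⟨e'.inv ≫ (HFunctor k hT).map h, ?_⟩
  rw [Category.assoc, ← Category.assoc ((HFunctor k hT).map h), ← Functor.map_comp, hg']
  simp

end H

end GhostTilting

/-! ### Assembly of the bijections -/

theorem theorem4p10 {k : Type w} [Field k] [IsAlgClosed k]
    {C : Type u} [Category.{v} C] [Preadditive C] [Linear k C] [HasZeroObject C] [HasShift C ℤ]
    [∀ n : ℤ, (shiftFunctor C n).Additive] [∀ n : ℤ, Functor.Linear k (shiftFunctor C n)]
    [Pretriangulated C] [IsTriangulated C]
    (hfin : ∀ X Y : C, Module.Finite k (X ⟶ Y)) (hKS : GhostTilting.IsKrullSchmidt C)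
    (T : ObjectProperty C) (hT : GhostTilting.IsClusterTilting T) :
    -- `ℍ⁻¹(Y)` makes sense for every weak tilting subcategory `Y`
    (∀ Y : ObjectProperty (GhostTilting.FPMod k T.FullSubcategory), GhostTilting.IsWeakTilting Y →
      ∃! X : ObjectProperty C,
        GhostTilting.IsWeakGhostClusterTilting T X ∧ GhostTilting.HImage k hT X = Y) ∧
    Set.BijOn (GhostTilting.HImage k hT)
      {X | GhostTilting.IsWeakGhostClusterTilting T X ∧ GhostTilting.NoSummandsInShift T X ∧
        GhostTilting.FactorizationIdealVanishes T X}
      {Y | GhostTilting.IsWeakTilting Y} ∧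
    Set.BijOn (GhostTilting.HImage k hT)
      {X | GhostTilting.IsGhostClusterTilting T X ∧ GhostTilting.NoSummandsInShift T X ∧
        GhostTilting.FactorizationIdealVanishes T X}
      {Y | GhostTilting.IsTilting Y ∧
        GhostTilting.ContravariantlyFinite (GhostTilting.HPreimage k hT Y)} ∧
    ∀ S : GhostTilting.SerreFunctor k C,
      Set.BijOn (GhostTilting.HImage k hT)
        {X | GhostTilting.IsClusterTilting X ∧ GhostTilting.NoSummandsInShift T X ∧
          GhostTilting.FactorizationIdealVanishes T X}
        {Y | GhostTilting.IsTilting Y ∧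
          GhostTilting.ContravariantlyFinite (GhostTilting.HPreimage k hT Y) ∧
          S.FStable (GhostTilting.HPreimage k hT Y)} := by
  -- `ℍ⁻¹` undoes `ℍ` here, which gives injectivity in all three cases and transfers the conditions
  -- on `ℍ⁻¹(Y)` to `X`.
  have hpre : ∀ X : ObjectProperty C, GhostTilting.IsWeakGhostClusterTilting T X →
      GhostTilting.FactorizationIdealVanishes T X →
      GhostTilting.HPreimage k hT (GhostTilting.HImage k hT X) = X := fun X hX hI => by
    have hY := hX.isWeakTilting_HImage k hT hKS hI
    rw [hY.HPreimage_eq hT hKS, ← hY.eq_HLift hT hKS hX rfl]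
  have hvan : ∀ Y : ObjectProperty (GhostTilting.FPMod k T.FullSubcategory),
      GhostTilting.NoSummandsInShift T (GhostTilting.HLift k hT Y) ∧
        GhostTilting.FactorizationIdealVanishes T (GhostTilting.HLift k hT Y) := fun Y =>
    ⟨(GhostTilting.HLift_factorizationIdealVanishes hT Y).noSummandsInShift,
      GhostTilting.HLift_factorizationIdealVanishes hT Y⟩
  refine ⟨fun Y hY => ⟨GhostTilting.HLift k hT Y,
    ⟨hY.isWeakGhostClusterTilting_HLift hT hKS, hY.HImage_HLift hT hKS⟩,
    fun X hX => hY.eq_HLift hT hKS hX.1 hX.2⟩, ⟨?_, ?_, ?_⟩, ⟨?_, ?_, ?_⟩, fun S => ⟨?_, ?_, ?_⟩⟩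
  · rintro X ⟨hX, -, hI⟩
    exact hX.isWeakTilting_HImage k hT hKS hI
  · rintro X ⟨hX, -, hI⟩ X' ⟨hX', -, hI'⟩ h
    rw [← hpre X hX hI, ← hpre X' hX' hI', h]
  · intro Y hY
    exact ⟨_, ⟨hY.isWeakGhostClusterTilting_HLift hT hKS, hvan Y⟩, hY.HImage_HLift hT hKS⟩
  · rintro X ⟨hX, -, hI⟩
    refine ⟨⟨(hX.isWeak hT).isWeakTilting_HImage k hT hKS hI,
      GhostTilting.contravariantlyFinite_HImage k hT hX.contravariantlyFinite⟩, ?_⟩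
    rw [hpre X (hX.isWeak hT) hI]
    exact hX.contravariantlyFinite
  · rintro X ⟨hX, -, hI⟩ X' ⟨hX', -, hI'⟩ h
    rw [← hpre X (hX.isWeak hT) hI, ← hpre X' (hX'.isWeak hT) hI', h]
  · rintro Y ⟨hY, hc⟩
    rw [hY.HPreimage_eq hT hKS] at hc
    exact ⟨_, ⟨(hY.isWeakGhostClusterTilting_HLift hT hKS).isGhost hc, hvan Y⟩,
      hY.HImage_HLift hT hKS⟩
  · rintro X ⟨hX, -, hI⟩
    have hX' := (hT.isGhost hX).isWeak hT
    refine ⟨⟨hX'.isWeakTilting_HImage k hT hKS hI,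
      GhostTilting.contravariantlyFinite_HImage k hT hX.contravariantlyFinite⟩, ?_⟩
    rw [hpre X hX' hI]
    exact ⟨hX.contravariantlyFinite, hX.fStable S⟩
  · rintro X ⟨hX, -, hI⟩ X' ⟨hX', -, hI'⟩ h
    rw [← hpre X ((hT.isGhost hX).isWeak hT) hI, ← hpre X' ((hT.isGhost hX').isWeak hT) hI', h]
  · rintro Y ⟨hY, hc, hF⟩
    rw [hY.HPreimage_eq hT hKS] at hc hF
    exact ⟨_, ⟨((hY.isWeakGhostClusterTilting_HLift hT hKS).isGhost hc).isClusterTilting hT S hF,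
      hvan Y⟩, hY.HImage_HLift hT hKS⟩
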